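/- **Setting.** Let $\mathcal M$ be a compact smooth $d$-dimensional manifold without boundary, and let $\iota^{(\ell)}:\mathcal M\to\mathbb R^{p_\ell}$, $\ell=1,2$, be $C^4$ embeddings. Let $dV^{(2)}$ be the Riemannian volume measure of the metric induced on $\mathcal M$ by $\iota^{(2)}$ from $\mathbb R^{p_2}$. Let $\nu=p\,dV^{(2)}$ and $\nu^{\mathcal Z}=p_{\mathcal Z}\,dV^{(2)}$ be probability measures on $\mathcal M$, where $p\in C^4(\mathcal M)$ and $p_{\mathcal Z}\in C(\mathcal M)$ are bounded below by positive constants. Let $\tilde K^{(1)},\tilde K^{(2)}:[0,\infty)\to(0,\infty)$ be $C^3$ functions such that, for some $c_1,c_2>0$ and all $t\ge 0$, $\tilde K^{(\ell)}(t)<c_1e^{-c_2t^2}$ and $|\partial_t\tilde K^{(\ell)}(t)|<c_1e^{-c_2t^2}$, and such that $\int_{\mathbb R^d}\tilde K^{(\ell)}(\|x\|)\,dx=1$. Fix $q\in\{1,2\}$ and, for $\epsilon>0$, put $$K^{(\ell)}_\epsilon(x,y)=\tilde K^{(\ell)}\Big(\big(\|\iota^{(\ell)}(x)-\iota^{(\ell)}(y)\|/\sqrt\epsilon\big)^q\Big).$$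 Fix $\alpha\in[0,1]$ and define $$d^{(2)}_\epsilon(z)=\int_{\mathcal M}\int_{\mathcal M}K^{(2)}_\epsilon(z,x)K^{(2)}_\epsilon(x,z')\,d\nu(x)\,d\nu^{\mathcal Z}(z'),\qquad K_{\epsilon,\alpha}(x,y)=\int_{\mathcal M}\frac{K^{(1)}_\epsilon(x,z')K^{(2)}_\epsilon(z',y)}{d^{(2)}_\epsilon(z')^{\alpha}}\,d\nu^{\mathcal Z}(z'),$$ $$T_{\epsilon,\alpha}f(x)=\int_{\mathcal M}\frac{K_{\epsilon,\alpha}(x,y)}{\int_{\mathcal M}K_{\epsilon,\alpha}(x,y')\,d\nu(y')}\,f(y)\,d\nu(y).$$ **Matrices.** Fix $\beta\in(0,1]$. Let $x_1,x_2,\dots$ be i.i.d. with law $\nu$ and $z_1,z_2,\dots$ i.i.d. with law $\nu^{\mathcal Z}$, the two sequences being independent of each other. For given $n$ and $\epsilon$ let $m=\lceil n^\beta\rceil$ and define the $n\times m$ matrices $\mathbf W^{(\ell)}_{ik}=K^{(\ell)}_\epsilon(x_i,z_k)$ and $$\mathbf D^{(2)}=\mathrm{diag}\big(\mathbf W^{(2)\top}\mathbf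 W^{(2)}\mathbf 1_m\big),\qquad \mathbf M^{(2)}_\alpha=\mathbf W^{(2)}(\mathbf D^{(2)})^{-\alpha},\qquad \mathbf D^{(1)}_\alpha=\mathrm{diag}\big(\mathbf W^{(1)}\mathbf M^{(2)\top}_\alpha\mathbf 1_n\big).$$ **Theorem.** Let $f\in C^3(\mathcal M)$ and write $\boldsymbol f=(f(x_1),\dots,f(x_n))^\top$. There is a constant $C>0$, depending on the data above and on $f$, but not on the bandwidths, with the following property. Let $\epsilon=\epsilon(n)>0$ be any sequence such that, as $n\to\infty$, $$\epsilon\to 0\qquad\text{and}\qquad \frac{\sqrt{\log n}}{n^{\beta/2}\epsilon^{d/4+1}}\to 0 .$$ Then for all sufficiently large $n$, with probability at least $1-C/n^2$, the inequality $$\left|\frac1\epsilon\Big[\big(I_n-(\mathbf D^{(1)}_\alpha)^{-1}\mathbf W^{(1)}\mathbf M^{(2)\top}_\alpha\big)\boldsymbol f\Big](i)-\frac{f(x_i)-T_{\epsilon,\alpha}f(x_i)}{\epsilon}\right|\le C\,\frac{\sqrt{\log n}}{n^{\beta/2}\epsilon^{d/4+1}}$$ holds for all $i=1,\dots,n$ simultaneously.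 -/

import Mathlib

open MeasureTheory ProbabilityTheory Filter Topology
open scoped Manifold ContDiff Matrix

namespace LAD

noncomputable section

/-- Admissible kernel profiles `K : [0, ∞) → (0, ∞)` in dimension `d`: `C³` on `[0, ∞)`, positive,
with Gaussian bounds on `K` and its derivative, and normalized by `∫_{ℝᵈ} K(‖x‖) dx = 1`.
Only the values on `[0, ∞)` matter. -/
structure IsKernelProfile (d : ℕ) (K : ℝ → ℝ) : Prop where
  contDiffOn : ContDiffOn ℝ 3 K (Set.Ici 0)
  pos : ∀ t, 0 ≤ t → 0 < K t
  decay : ∃ c₁ > 0, ∃ c₂ > 0, ∀ t, 0 ≤ t →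
    K t < c₁ * Real.exp (-c₂ * t ^ 2) ∧
    |derivWithin K (Set.Ici 0) t| < c₁ * Real.exp (-c₂ * t ^ 2)
  integral_eq_one : ∫ x : EuclideanSpace ℝ (Fin d), K ‖x‖ = 1

section Volume

variable {d p : ℕ} {M : Type*} [TopologicalSpace M]

/-- The Gram matrix `g_{ab}(u) = ⟨∂_a (ι ∘ φ⁻¹)(u), ∂_b (ι ∘ φ⁻¹)(u)⟩`: the metric induced on `M`
by `ι : M → ℝᵖ` from the canonical metric of `ℝᵖ`, written in the chart `φ`. -/
def metricInChart (ι : M → EuclideanSpace ℝ (Fin p))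
    (φ : OpenPartialHomeomorph M (EuclideanSpace ℝ (Fin d))) (u : EuclideanSpace ℝ (Fin d)) :
    Matrix (Fin d) (Fin d) ℝ :=
  Matrix.of fun a b =>
    inner ℝ (fderiv ℝ (ι ∘ φ.symm) u (EuclideanSpace.single a 1))
      (fderiv ℝ (ι ∘ φ.symm) u (EuclideanSpace.single b 1))

/-- The volume measure `√(det g(u)) du` of the induced metric on the domain of the chart `φ`
(carried by `φ.source`). -/
def chartVolume [MeasurableSpace M] (ι : M → EuclideanSpace ℝ (Fin p))
    (φ : OpenPartialHomeomorph M (EuclideanSpace ℝ (Fin d))) : Measure M :=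
  ((volume.restrict φ.target).withDensity
    fun u => ENNReal.ofReal (Real.sqrt (metricInChart ι φ u).det)).map φ.symm

/-- The Riemannian volume measure `dV` on `M` of the metric induced by `ι : M → ℝᵖ`. By the change
of variables formula the chart volumes agree on overlaps of chart domains, so they glue to one
measure, whose restriction to each chart domain is the chart volume there; it is their least upper
bound in the complete lattice of measures on `M`. -/
def riemannianVolume [MeasurableSpace M] [ChartedSpace (EuclideanSpace ℝ (Fin d)) M]
    (ι : M → EuclideanSpace ℝ (Fin p)) : Measure M :=
  ⨆ φ ∈ atlas (EuclideanSpace ℝ (Fin d)) M, chartVolume ι φ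

end Volume

section Kernels

variable {M : Type*} {p₁ p₂ : ℕ}

/-- The kernel `K_ε(x, y) = K((‖ι x - ι y‖ / √ε) ^ q)`; for `q = 2` it is `K(‖ι x - ι y‖² / ε)`,
for `q = 1` it is `K(‖ι x - ι y‖ / √ε)`. -/
def kernel (q : ℕ) (K : ℝ → ℝ) {p : ℕ} (ι : M → EuclideanSpace ℝ (Fin p)) (ε : ℝ) (x y : M) : ℝ :=
  K ((‖ι x - ι y‖ / Real.sqrt ε) ^ q)

/-! ### The integral operator -/

variable [MeasurableSpace M]

/-- The landmark kernel `∫ k₂(z, x) k₂(x, z') dν(x)`. -/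
def landmarkKernel (k₂ : M → M → ℝ) (ν : Measure M) (z z' : M) : ℝ :=
  ∫ x, k₂ z x * k₂ x z' ∂ν

/-- The landmark degree function. -/
def landmarkDegree (k₂ : M → M → ℝ) (ν νZ : Measure M) (z : M) : ℝ :=
  ∫ z', landmarkKernel k₂ ν z z' ∂νZ

/-- The `α`-landmark alternating diffusion kernel. -/
def adKernel (k₁ k₂ : M → M → ℝ) (ν νZ : Measure M) (α : ℝ) (x y : M) : ℝ :=
  ∫ z', k₁ x z' * k₂ z' y / landmarkDegree k₂ ν νZ z' ^ α ∂νZ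

/-- The `α`-landmark alternating degree function. -/
def adDegree (k₁ k₂ : M → M → ℝ) (ν νZ : Measure M) (α : ℝ) (x : M) : ℝ :=
  ∫ y, adKernel k₁ k₂ ν νZ α x y ∂ν

/-- The landmark alternating diffusion operator `T`. -/
def adOperator (k₁ k₂ : M → M → ℝ) (ν νZ : Measure M) (α : ℝ) (f : M → ℝ) (x : M) : ℝ :=
  ∫ y, adKernel k₁ k₂ ν νZ α x y / adDegree k₁ k₂ ν νZ α x * f y ∂ν

end Kernels

section Matrices

/-! ### The matrices of the algorithm

`n` samples `x`, `m` landmarks `z`, affinities `k₁`, `k₂` of the two sensors. -/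

variable {M : Type*} {n m : ℕ}

/-- The landmark affinity matrix of one sensor. -/
def affinity (k : M → M → ℝ) (x : Fin n → M) (z : Fin m → M) : Matrix (Fin n) (Fin m) ℝ :=
  Matrix.of fun i j => k (x i) (z j)

/-- The diagonal of `D⁽²⁾ = diag(W⁽²⁾ᵀ W⁽²⁾ 1)`. -/
def degreeTwo (k₂ : M → M → ℝ) (x : Fin n → M) (z : Fin m → M) : Fin m → ℝ :=
  ((affinity k₂ x z)ᵀ * affinity k₂ x z) *ᵥ 1

/-- The landmark diffusion matrix of the second sensor, `M⁽²⁾ = W⁽²⁾ (D⁽²⁾)^(-α)`. -/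
def diffusionTwo (k₂ : M → M → ℝ) (α : ℝ) (x : Fin n → M) (z : Fin m → M) :
    Matrix (Fin n) (Fin m) ℝ :=
  affinity k₂ x z * Matrix.diagonal fun k => degreeTwo k₂ x z k ^ (-α)

/-- The degree matrix `D⁽¹⁾ = diag(W⁽¹⁾ M⁽²⁾ᵀ 1)`. -/
def degreeOne (k₁ k₂ : M → M → ℝ) (α : ℝ) (x : Fin n → M) (z : Fin m → M) :
    Matrix (Fin n) (Fin n) ℝ :=
  Matrix.diagonal ((affinity k₁ x z * (diffusionTwo k₂ α x z)ᵀ) *ᵥ 1)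

/-- The landmark diffusion matrix of the first sensor, `M⁽¹⁾ = (D⁽¹⁾)⁻¹ W⁽¹⁾`. -/
def diffusionOne (k₁ k₂ : M → M → ℝ) (α : ℝ) (x : Fin n → M) (z : Fin m → M) :
    Matrix (Fin n) (Fin m) ℝ :=
  (degreeOne k₁ k₂ α x z)⁻¹ * affinity k₁ x z

/-- The landmark alternating diffusion matrix `M⁽¹⁾ M⁽²⁾ᵀ = (D⁽¹⁾)⁻¹ W⁽¹⁾ M⁽²⁾ᵀ`. -/
def ladMatrix (k₁ k₂ : M → M → ℝ) (α : ℝ) (x : Fin n → M) (z : Fin m → M) :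
    Matrix (Fin n) (Fin n) ℝ :=
  diffusionOne k₁ k₂ α x z * (diffusionTwo k₂ α x z)ᵀ

end Matrices

/-- The rate `√(log n) / (n^(β/2) ε^(d/4+1))`. -/
def rate (d : ℕ) (β : ℝ) (n : ℕ) (ε : ℝ) : ℝ :=
  Real.sqrt (Real.log n) / ((n : ℝ) ^ (β / 2) * ε ^ ((d : ℝ) / 4 + 1))

end

end LAD

/-!
Both `(D⁽¹⁾)⁻¹ W⁽¹⁾ M⁽²⁾ᵀ f` and `T f` are ratios of iterated averages with the same structure:
apply `k₂` to `f`, multiply by `d ^ (-α)`, apply `k₁`, and divide by the result for `f = 1`. In the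
matrix the averages are empirical, in the operator they are integrals; the powers of the sample
sizes cancel (`LAD.ladMatrix_mulVec`, `LAD.IsNormalizedPair.adOperator_eq`). Neither side changes
when both kernels are multiplied by `ε ^ (-d/2)`, and after this normalization the
integrals of the kernels, and with them all integrals for `f = 1`, lie between two positive
constants that do not depend on `ε`.

*Concentration.* A normalized kernel is bounded by `B = O(ε ^ (-d/2))` and has integrals of order
`1`, so the variance of `k(ξ, ·) g` is `O(B)` for bounded `g`. Bernstein's inequality makes an
average over `N` sample points deviate by more than `η` with probability at most
`2 exp(-c N η² ε ^ (d/2))`. Every average in the matrix can be read as an average over the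
landmarks at a sample point or over the samples at a landmark, and the two families are
independent. So conditioning on the point and a union bound give the estimate at all points
simultaneously (`LAD.measureReal_exists_deviation_le`). With `η` of order `ε · rate` and at least `n ^ β` terms in
each average, the exceptional probability is `O(n ^ (-2))`. All errors propagate linearly through
powers, products and quotients (`LAD.IsNormalizedPair.abs_ladMatrix_sub_adOperator_le`), so the
matrix is within `O(ε · rate)` of the operator; dividing by `ε` gives the claim.

*Geometry.* The two-sided integral bounds come from the fact that `{y | ‖ι x - ι y‖ ≤ r}` has
Riemannian volume of order `r ^ d`, uniformly in `x`, for each of the two embeddings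
(`LAD.riemannianVolume_extrinsicBall`). Near every point an embedding read in a chart is
bi-Lipschitz and its Gram determinant is bounded above and below, and compactness makes this
uniform. The volume is a supremum over all charts of the atlas; it is bounded by finitely many of
them because chart volumes agree on overlaps (`LAD.chartVolume_inter_source_le`).
-/

namespace LAD

/-! ### The induced volume in charts -/

section Gram

variable {d p : ℕ}

/-- The Gram determinant of `A ∘ T` is `(det T)²` times that of `A`. -/
theorem det_gram_comp (A : EuclideanSpace ℝ (Fin d) →L[ℝ] EuclideanSpace ℝ (Fin p))
    (T : EuclideanSpace ℝ (Fin d) →L[ℝ] EuclideanSpace ℝ (Fin d)) :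
    (Matrix.of fun a b : Fin d => inner ℝ (A (T (EuclideanSpace.single a 1)))
      (A (T (EuclideanSpace.single b 1)))).det =
    T.det ^ 2 * (Matrix.of fun a b : Fin d => inner ℝ (A (EuclideanSpace.single a 1))
      (A (EuclideanSpace.single b 1))).det := by
  set G := Matrix.of fun a b : Fin d => inner ℝ (A (EuclideanSpace.single a 1))
      (A (EuclideanSpace.single b 1)) with hG
  set e := (EuclideanSpace.basisFun (Fin d) ℝ).toBasis
  set J := LinearMap.toMatrix e e T.toLinearMap with hJ
  have hJdet : J.det = T.det := LinearMap.det_toMatrix e T.toLinearMap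
  have hT : ∀ a, T (EuclideanSpace.single a 1) = ∑ c, J c a • EuclideanSpace.single c (1 : ℝ) := by
    intro a
    have := (e.sum_repr (T (EuclideanSpace.single a 1))).symm
    rw [this]
    refine Finset.sum_congr rfl fun c _ => ?_
    simp [hJ, LinearMap.toMatrix_apply, e]
  have hmat : (Matrix.of fun a b : Fin d => inner ℝ (A (T (EuclideanSpace.single a 1)))
      (A (T (EuclideanSpace.single b 1)))) = Jᵀ * G * J := by
    ext a b
    simp only [Matrix.of_apply, hT, map_sum, map_smul, sum_inner, inner_sum, inner_smul_left,
      inner_smul_right, Matrix.mul_apply, Matrix.transpose_apply, hG, Finset.sum_mul]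
    refine Finset.sum_congr rfl fun c _ => ?_
    rw [Finset.mul_sum]
    refine Finset.sum_congr rfl fun c' _ => ?_
    simp only [conj_trivial]
    ring
  rw [hmat, Matrix.det_mul, Matrix.det_mul, Matrix.det_transpose, hJdet]
  ring

end Gram

section ChartVolume

variable {d p : ℕ} {M : Type*} [TopologicalSpace M]

/-- The density `√(det g)` of the induced volume in the chart `φ`, as it enters `chartVolume`. -/
noncomputable def volumeDensity (ι : M → EuclideanSpace ℝ (Fin p))
    (φ : OpenPartialHomeomorph M (EuclideanSpace ℝ (Fin d))) (u : EuclideanSpace ℝ (Fin d)) : ℝ :=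
  Real.sqrt (metricInChart ι φ u).det

theorem chartVolume_apply [MeasurableSpace M] [BorelSpace M] (ι : M → EuclideanSpace ℝ (Fin p))
    (φ : OpenPartialHomeomorph M (EuclideanSpace ℝ (Fin d))) {S : Set M} (hS : MeasurableSet S) :
    chartVolume ι φ S =
      ∫⁻ u in φ.symm ⁻¹' S ∩ φ.target, ENNReal.ofReal (volumeDensity ι φ u) := by
  have hφ : AEMeasurable φ.symm (volume.restrict φ.target) :=
    φ.continuousOn_symm.aemeasurable φ.open_target.measurableSet
  unfold chartVolume
  rw [Measure.map_apply_of_aemeasurable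
    (hφ.mono_ac (withDensity_absolutelyContinuous _ _)) hS, withDensity_apply',
    Measure.restrict_restrict' φ.open_target.measurableSet]
  rfl

theorem measurableSet_symm_preimage_inter_target [MeasurableSpace M] [BorelSpace M]
    (φ : OpenPartialHomeomorph M (EuclideanSpace ℝ (Fin d))) {S : Set M} (hS : MeasurableSet S) :
    MeasurableSet (φ.symm ⁻¹' S ∩ φ.target) := by
  have h := φ.continuousOn_symm.domRestrict.measurable hS
  have := (MeasurableEmbedding.subtype_coe φ.open_target.measurableSet).measurableSet_image.2 h
  convert this using 1
  ext u
  simp [Set.domRestrict, and_comm]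

variable [ChartedSpace (EuclideanSpace ℝ (Fin d)) M]

theorem contDiffOn_comp_symm {n : ℕ∞ω} {ι : M → EuclideanSpace ℝ (Fin p)}
    (hι : ContMDiff (𝓡 d) 𝓘(ℝ, EuclideanSpace ℝ (Fin p)) n ι)
    {φ : OpenPartialHomeomorph M (EuclideanSpace ℝ (Fin d))}
    (hφ : φ ∈ IsManifold.maximalAtlas (𝓡 d) n M) :
    ContDiffOn ℝ n (ι ∘ φ.symm) φ.target :=
  contMDiffOn_iff_contDiffOn.1 (hι.comp_contMDiffOn (contMDiffOn_symm_of_mem_maximalAtlas hφ))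

/-- Chart volumes are compatible on overlaps of chart domains, by the change of variables formula
and the transformation rule of the Gram determinant. One inequality suffices, as `φ` and `ψ` can be
exchanged. -/
theorem chartVolume_inter_source_le [MeasurableSpace M] [BorelSpace M]
    {ι : M → EuclideanSpace ℝ (Fin p)}
    (hι : ContMDiff (𝓡 d) 𝓘(ℝ, EuclideanSpace ℝ (Fin p)) 1 ι)
    {φ ψ : OpenPartialHomeomorph M (EuclideanSpace ℝ (Fin d))}
    (hφ : φ ∈ IsManifold.maximalAtlas (𝓡 d) 1 M) (hψ : ψ ∈ IsManifold.maximalAtlas (𝓡 d) 1 M)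
    {A : Set M} (hA : MeasurableSet A) :
    chartVolume ι φ (A ∩ ψ.source) ≤ chartVolume ι ψ A := by
  have hAψ : MeasurableSet (A ∩ ψ.source) := hA.inter ψ.open_source.measurableSet
  rw [chartVolume_apply ι φ hAψ, chartVolume_apply ι ψ hA]
  set s := φ.symm ⁻¹' (A ∩ ψ.source) ∩ φ.target with hs
  have hs_meas : MeasurableSet s := measurableSet_symm_preimage_inter_target φ hAψ
  set τ := ψ ∘ φ.symm with hτ
  have hτ_diff : ∀ u ∈ s, DifferentiableAt ℝ τ u := by
    rintro u ⟨⟨_, hu⟩, hut⟩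
    have h1 : ContMDiffAt (𝓡 d) (𝓡 d) 1 ψ (φ.symm u) := contMDiffAt_of_mem_maximalAtlas hψ hu
    have h2 : ContMDiffAt (𝓡 d) (𝓡 d) 1 φ.symm u :=
      (contMDiffOn_symm_of_mem_maximalAtlas hφ).contMDiffAt (φ.open_target.mem_nhds hut)
    exact (contMDiffAt_iff_contDiffAt.1 (h1.comp u h2)).differentiableAt one_ne_zero
  have hτ_inj : Set.InjOn τ s := by
    rintro u ⟨⟨_, hu⟩, hut⟩ v ⟨⟨_, hv⟩, hvt⟩ huv
    exact φ.symm.injOn hut hvt (ψ.injOn hu hv huv)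
  have himage : τ '' s ⊆ ψ.symm ⁻¹' A ∩ ψ.target := by
    rintro _ ⟨u, ⟨⟨huA, hu⟩, hut⟩, rfl⟩
    refine ⟨?_, ψ.map_source hu⟩
    simpa [hτ, ψ.left_inv hu] using huA
  have hdens : ∀ u ∈ s, volumeDensity ι φ u = |(fderiv ℝ τ u).det| * volumeDensity ι ψ (τ u) := by
    rintro u ⟨⟨huA, hu⟩, hut⟩
    have hψu : DifferentiableAt ℝ (ι ∘ ψ.symm) (τ u) :=
      ((contDiffOn_comp_symm hι hψ).contDiffAt
        (ψ.open_target.mem_nhds (ψ.map_source hu))).differentiableAt one_ne_zero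
    have heq : ι ∘ φ.symm =ᶠ[𝓝 u] (ι ∘ ψ.symm) ∘ τ := by
      have hnhds : ∀ᶠ v in 𝓝 u, φ.symm v ∈ ψ.source :=
        (φ.continuousAt_symm hut).eventually (ψ.open_source.mem_nhds hu)
      filter_upwards [hnhds] with v hv
      simp [hτ, ψ.left_inv hv]
    have hfd : fderiv ℝ (ι ∘ φ.symm) u = (fderiv ℝ (ι ∘ ψ.symm) (τ u)).comp (fderiv ℝ τ u) := by
      rw [heq.fderiv_eq, fderiv_comp u hψu (hτ_diff u ⟨⟨huA, hu⟩, hut⟩)]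
    unfold volumeDensity metricInChart
    rw [hfd]
    simp only [ContinuousLinearMap.comp_apply]
    rw [det_gram_comp, Real.sqrt_mul (sq_nonneg _), Real.sqrt_sq_eq_abs]
  calc ∫⁻ u in s, ENNReal.ofReal (volumeDensity ι φ u)
      = ∫⁻ u in s, ENNReal.ofReal |(fderiv ℝ τ u).det| *
          ENNReal.ofReal (volumeDensity ι ψ (τ u)) := by
        refine setLIntegral_congr_fun hs_meas fun u hu => ?_
        simp only [hdens u hu]
        rw [ENNReal.ofReal_mul (abs_nonneg _)]
    _ = ∫⁻ v in τ '' s, ENNReal.ofReal (volumeDensity ι ψ v) :=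
        (lintegral_image_eq_lintegral_abs_det_fderiv_mul volume hs_meas
          (fun u hu => (hτ_diff u hu).hasFDerivAt.hasFDerivWithinAt) hτ_inj
          fun v => ENNReal.ofReal (volumeDensity ι ψ v)).symm
    _ ≤ _ := lintegral_mono_set himage

end ChartVolume

/-! ### Local geometry of an embedding -/

section Local

variable {d p : ℕ} {M : Type*} [TopologicalSpace M]
  [ChartedSpace (EuclideanSpace ℝ (Fin d)) M] [IsManifold (𝓡 d) 1 M]

/-- Near every point, a chart factors through an immersion by a `C¹` map of the ambient space. -/
theorem exists_retraction_of_isImmersionAt {n : ℕ∞ω} (hn : 1 ≤ n)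
    {ι : M → EuclideanSpace ℝ (Fin p)} {x₀ : M}
    (h : Manifold.IsImmersionAt (𝓡 d) 𝓘(ℝ, EuclideanSpace ℝ (Fin p)) n ι x₀) :
    ∃ G : EuclideanSpace ℝ (Fin p) → EuclideanSpace ℝ (Fin d), ContDiffAt ℝ 1 G (ι x₀) ∧
      ∀ᶠ y in 𝓝 x₀, G (ι y) = chartAt (EuclideanSpace ℝ (Fin d)) x₀ y := by
  set φ := chartAt (EuclideanSpace ℝ (Fin d)) x₀
  set D := h.domChart
  set Ψ := h.codChart
  have hx : x₀ ∈ D.source := h.mem_domChart_source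
  let π : EuclideanSpace ℝ (Fin p) → EuclideanSpace ℝ (Fin d) := fun v => (h.equiv.symm v).1
  have key : ∀ y ∈ D.source, D.symm (π (Ψ (ι y))) = y := by
    intro y hy
    have hw := h.writtenInCharts
      (show D y ∈ (D.extend (𝓡 d)).target by simpa using D.map_source hy)
    have : Ψ (ι y) = h.equiv (D y, 0) := by
      simpa [D.left_inv hy, D, Ψ] using hw
    simp [this, π, D.left_inv hy]
  have hπ : ContDiff ℝ 1 π := contDiff_fst.comp h.equiv.symm.contDiff
  refine ⟨fun v => φ (D.symm (π (Ψ v))), ?_, ?_⟩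
  · have hD : π (Ψ (ι x₀)) = D x₀ := by
      have hw := h.writtenInCharts
        (show D x₀ ∈ (D.extend (𝓡 d)).target by simpa using D.map_source hx)
      have : Ψ (ι x₀) = h.equiv (D x₀, 0) := by
        simpa [D.left_inv hx, D, Ψ] using hw
      simp [this, π]
    have h1 : ContMDiffAt 𝓘(ℝ, EuclideanSpace ℝ (Fin p)) 𝓘(ℝ, EuclideanSpace ℝ (Fin p)) 1 Ψ
        (ι x₀) :=
      (contMDiffAt_of_mem_maximalAtlas h.codChart_mem_maximalAtlas
        h.mem_codChart_source).of_le hn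
    have h2 : ContMDiffAt 𝓘(ℝ, EuclideanSpace ℝ (Fin p)) (𝓡 d) 1 (fun v => π (Ψ v)) (ι x₀) :=
      hπ.contMDiff.contMDiffAt.comp (ι x₀) h1
    have h3 : ContMDiffAt (𝓡 d) (𝓡 d) 1 D.symm (π (Ψ (ι x₀))) := by
      rw [hD]
      exact ((contMDiffOn_symm_of_mem_maximalAtlas h.domChart_mem_maximalAtlas).contMDiffAt
        (D.open_target.mem_nhds (D.map_source hx))).of_le hn
    have h4 : ContMDiffAt (𝓡 d) (𝓡 d) 1 φ (D.symm (π (Ψ (ι x₀)))) := by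
      rw [key x₀ hx]
      exact contMDiffAt_of_mem_maximalAtlas
        (IsManifold.subset_maximalAtlas (chart_mem_atlas _ x₀)) (mem_chart_source _ x₀)
    exact contMDiffAt_iff_contDiffAt.1 (h4.comp (ι x₀) (h3.comp (ι x₀) h2))
  · filter_upwards [D.open_source.mem_nhds hx] with y hy
    rw [key y hy]

/-- In the chart at `x₀` an immersion is bi-Lipschitz near the image of `x₀`. -/
theorem exists_biLipschitz_of_isImmersionAt {n : ℕ∞ω} (hn : 1 ≤ n)
    {ι : M → EuclideanSpace ℝ (Fin p)} {x₀ : M}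
    (hι : ContMDiff (𝓡 d) 𝓘(ℝ, EuclideanSpace ℝ (Fin p)) 1 ι)
    (h : Manifold.IsImmersionAt (𝓡 d) 𝓘(ℝ, EuclideanSpace ℝ (Fin p)) n ι x₀) :
    ∃ L > 0, ∃ s ∈ 𝓝 (chartAt (EuclideanSpace ℝ (Fin d)) x₀ x₀), ∀ u ∈ s, ∀ v ∈ s,
      ‖u - v‖ ≤ L * ‖ι ((chartAt (EuclideanSpace ℝ (Fin d)) x₀).symm u) -
        ι ((chartAt (EuclideanSpace ℝ (Fin d)) x₀).symm v)‖ ∧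
      ‖ι ((chartAt (EuclideanSpace ℝ (Fin d)) x₀).symm u) -
        ι ((chartAt (EuclideanSpace ℝ (Fin d)) x₀).symm v)‖ ≤ L * ‖u - v‖ := by
  obtain ⟨G, hG, hGι⟩ := exists_retraction_of_isImmersionAt hn h
  set φ := chartAt (EuclideanSpace ℝ (Fin d)) x₀ with hφ
  have hxt : φ x₀ ∈ φ.target := mem_chart_target _ x₀
  have hxs : φ.symm (φ x₀) = x₀ := φ.left_inv (mem_chart_source _ x₀)
  have hF : ContDiffAt ℝ 1 (ι ∘ φ.symm) (φ x₀) :=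
    (contDiffOn_comp_symm hι (IsManifold.subset_maximalAtlas (chart_mem_atlas _ x₀))).contDiffAt
      (φ.open_target.mem_nhds hxt)
  obtain ⟨K, t, ht, hGL⟩ := hG.exists_lipschitzOnWith
  obtain ⟨K', t', ht', hFL⟩ := hF.exists_lipschitzOnWith
  have hsymm : Tendsto φ.symm (𝓝 (φ x₀)) (𝓝 x₀) := by
    have := φ.continuousAt_symm hxt
    rwa [ContinuousAt, hxs] at this
  have hF' : Tendsto (ι ∘ φ.symm) (𝓝 (φ x₀)) (𝓝 (ι x₀)) := by
    have := hF.continuousAt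
    rwa [ContinuousAt, Function.comp_apply, hxs] at this
  refine ⟨K + K' + 1, by positivity, _,
    inter_mem (inter_mem ht' (hF' ht)) (inter_mem (hsymm.eventually hGι)
      (φ.open_target.mem_nhds hxt)), ?_⟩
  rintro u ⟨⟨hu1, hu2⟩, hu3, hu4⟩ v ⟨⟨hv1, hv2⟩, hv3, hv4⟩
  simp only [Set.mem_ofPred_eq, φ.right_inv hu4, φ.right_inv hv4] at hu3 hv3
  constructor
  · have := hGL.norm_sub_le hu2 hv2
    simp only [Function.comp_apply, hu3, hv3] at this
    refine this.trans (mul_le_mul_of_nonneg_right ?_ (norm_nonneg _))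
    have := K'.coe_nonneg; linarith
  · have := hFL.norm_sub_le hu1 hv1
    refine this.trans (mul_le_mul_of_nonneg_right ?_ (norm_nonneg _))
    have := K.coe_nonneg; linarith

/-- The volume density of an immersion is bounded above and away from zero near each point. -/
theorem exists_volumeDensity_bounds {n : ℕ∞ω} (hn : 1 ≤ n)
    {ι : M → EuclideanSpace ℝ (Fin p)} {x₀ : M}
    (hι : ContMDiff (𝓡 d) 𝓘(ℝ, EuclideanSpace ℝ (Fin p)) 1 ι)
    (h : Manifold.IsImmersionAt (𝓡 d) 𝓘(ℝ, EuclideanSpace ℝ (Fin p)) n ι x₀) :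
    ∃ a > 0, ∃ b > 0, ∀ᶠ u in 𝓝 (chartAt (EuclideanSpace ℝ (Fin d)) x₀ x₀),
      a ≤ volumeDensity ι (chartAt (EuclideanSpace ℝ (Fin d)) x₀) u ∧
        volumeDensity ι (chartAt (EuclideanSpace ℝ (Fin d)) x₀) u ≤ b := by
  obtain ⟨G, hG, hGι⟩ := exists_retraction_of_isImmersionAt hn h
  set φ := chartAt (EuclideanSpace ℝ (Fin d)) x₀ with hφ
  have hxt : φ x₀ ∈ φ.target := mem_chart_target _ x₀
  have hxs : φ.symm (φ x₀) = x₀ := φ.left_inv (mem_chart_source _ x₀)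
  have hF : ContDiffAt ℝ 1 (ι ∘ φ.symm) (φ x₀) :=
    (contDiffOn_comp_symm hι (IsManifold.subset_maximalAtlas (chart_mem_atlas _ x₀))).contDiffAt
      (φ.open_target.mem_nhds hxt)
  have hcont : ContinuousAt (fderiv ℝ (ι ∘ φ.symm)) (φ x₀) :=
    hF.continuousAt_fderiv one_ne_zero
  have hdens : ContinuousAt (volumeDensity ι φ) (φ x₀) := by
    unfold volumeDensity
    refine Real.continuous_sqrt.continuousAt.comp ?_
    have : ContinuousAt (metricInChart ι φ) (φ x₀) := by
      refine continuousAt_pi.2 fun a => continuousAt_pi.2 fun b => ?_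
      simp only [metricInChart, Matrix.of_apply]
      exact (hcont.clm_apply continuousAt_const).inner (hcont.clm_apply continuousAt_const)
    exact (Continuous.matrix_det continuous_id).continuousAt.comp this
  have hinj : Function.Injective (fderiv ℝ (ι ∘ φ.symm) (φ x₀)) := by
    have hsymm : Tendsto φ.symm (𝓝 (φ x₀)) (𝓝 x₀) := by
      have := φ.continuousAt_symm hxt
      rwa [ContinuousAt, hxs] at this
    have heq : G ∘ (ι ∘ φ.symm) =ᶠ[𝓝 (φ x₀)] id := by
      filter_upwards [hsymm.eventually hGι, φ.open_target.mem_nhds hxt] with u hu hut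
      simpa [φ.right_inv hut] using hu
    have hG' : DifferentiableAt ℝ G ((ι ∘ φ.symm) (φ x₀)) := by
      rw [Function.comp_apply, hxs]; exact hG.differentiableAt one_ne_zero
    have := heq.fderiv_eq (𝕜 := ℝ)
    rw [fderiv_comp _ hG' (hF.differentiableAt one_ne_zero), fderiv_id] at this
    refine Function.LeftInverse.injective (g := fderiv ℝ G ((ι ∘ φ.symm) (φ x₀))) fun u => ?_
    exact DFunLike.congr_fun this u
  have hpos : 0 < volumeDensity ι φ (φ x₀) := by
    refine Real.sqrt_pos.2 ?_
    have hli : LinearIndependent ℝ fun a : Fin d =>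
        fderiv ℝ (ι ∘ φ.symm) (φ x₀) (EuclideanSpace.single a 1) := by
      have hb := (EuclideanSpace.basisFun (Fin d) ℝ).toBasis.linearIndependent
      have hmap : LinearIndependent ℝ ((fderiv ℝ (ι ∘ φ.symm) (φ x₀) :
          EuclideanSpace ℝ (Fin d) →ₗ[ℝ] EuclideanSpace ℝ (Fin p)) ∘
            (EuclideanSpace.basisFun (Fin d) ℝ).toBasis) :=
        hb.map' _ (LinearMap.ker_eq_bot.2 hinj)
      simpa [Function.comp_def] using hmap
    exact (Matrix.posDef_gram_of_linearIndependent hli).det_pos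
  refine ⟨volumeDensity ι φ (φ x₀) / 2, by positivity, volumeDensity ι φ (φ x₀) + 1,
    by positivity, ?_⟩
  filter_upwards [hdens.eventually (lt_mem_nhds (half_lt_self hpos)),
    hdens.eventually (gt_mem_nhds (lt_add_one _))] with u h1 h2
  exact ⟨h1.le, h2.le⟩

end Local

/-! ### Volumes of extrinsic balls -/

section Balls

variable {d p p' : ℕ} {M : Type*} [TopologicalSpace M]

/-- The sublevel sets `{y | ‖κ x - κ y‖ ≤ r}`: balls of the extrinsic distance of `κ`. -/
def extrinsicBall (κ : M → EuclideanSpace ℝ (Fin p')) (x : M) (r : ℝ) : Set M :=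
  {y | ‖κ x - κ y‖ ≤ r}

theorem measurableSet_extrinsicBall [MeasurableSpace M] [BorelSpace M]
    {κ : M → EuclideanSpace ℝ (Fin p')} (hκ : Continuous κ) (x : M) (r : ℝ) :
    MeasurableSet (extrinsicBall κ x r) :=
  (isClosed_le (continuous_const.sub hκ).norm continuous_const).measurableSet

/-- A chart in which, on the ball of radius `2ρ` about `u₀`, the map `κ` is bi-Lipschitz with
constant `L` and the volume density of `ι` lies in `[a, b]`. -/
structure IsGoodChart (ι : M → EuclideanSpace ℝ (Fin p)) (κ : M → EuclideanSpace ℝ (Fin p'))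
    (φ : OpenPartialHomeomorph M (EuclideanSpace ℝ (Fin d))) (u₀ : EuclideanSpace ℝ (Fin d))
    (ρ L a b : ℝ) : Prop where
  radius_pos : 0 < ρ
  lipschitz_pos : 0 < L
  lower_pos : 0 < a
  upper_pos : 0 < b
  ball_subset : Metric.ball u₀ (2 * ρ) ⊆ φ.target
  antilipschitz : ∀ u ∈ Metric.ball u₀ (2 * ρ), ∀ v ∈ Metric.ball u₀ (2 * ρ),
    ‖u - v‖ ≤ L * ‖κ (φ.symm u) - κ (φ.symm v)‖
  lipschitz : ∀ u ∈ Metric.ball u₀ (2 * ρ), ∀ v ∈ Metric.ball u₀ (2 * ρ),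
    ‖κ (φ.symm u) - κ (φ.symm v)‖ ≤ L * ‖u - v‖
  le_density : ∀ u ∈ Metric.ball u₀ (2 * ρ), a ≤ volumeDensity ι φ u
  density_le : ∀ u ∈ Metric.ball u₀ (2 * ρ), volumeDensity ι φ u ≤ b

namespace IsGoodChart

variable {ι : M → EuclideanSpace ℝ (Fin p)} {κ : M → EuclideanSpace ℝ (Fin p')}
  {φ : OpenPartialHomeomorph M (EuclideanSpace ℝ (Fin d))} {u₀ : EuclideanSpace ℝ (Fin d)}
  {ρ L a b : ℝ}

theorem ball_subset_ball (h : IsGoodChart ι κ φ u₀ ρ L a b) :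
    Metric.ball u₀ ρ ⊆ Metric.ball u₀ (2 * ρ) :=
  Metric.ball_subset_ball (by linarith [h.radius_pos])

theorem chartVolume_le [MeasurableSpace M] [BorelSpace M] (h : IsGoodChart ι κ φ u₀ ρ L a b)
    (hκ : Continuous κ) (x : M) {r : ℝ} (hr : 0 < r) :
    chartVolume ι φ (extrinsicBall κ x r ∩ (φ.source ∩ φ ⁻¹' Metric.ball u₀ ρ)) ≤
      ENNReal.ofReal (b * ((2 * L) ^ d *
        volume.real (Metric.ball (0 : EuclideanSpace ℝ (Fin d)) 1)) * r ^ d) := by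
  have hmeas : MeasurableSet (extrinsicBall κ x r ∩ (φ.source ∩ φ ⁻¹' Metric.ball u₀ ρ)) :=
    (measurableSet_extrinsicBall hκ x r).inter
      (φ.isOpen_inter_preimage Metric.isOpen_ball).measurableSet
  rw [chartVolume_apply ι φ hmeas]
  set s := φ.symm ⁻¹' (extrinsicBall κ x r ∩ (φ.source ∩ φ ⁻¹' Metric.ball u₀ ρ)) ∩ φ.target
    with hs
  have hs_meas : MeasurableSet s := measurableSet_symm_preimage_inter_target φ hmeas
  have hmem : ∀ u ∈ s, u ∈ Metric.ball u₀ (2 * ρ) ∧ ‖κ x - κ (φ.symm u)‖ ≤ r := by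
    rintro u ⟨⟨hu1, _, hu2⟩, hut⟩
    refine ⟨h.ball_subset_ball ?_, hu1⟩
    simpa [φ.right_inv hut] using hu2
  rcases s.eq_empty_or_nonempty with hempty | ⟨v, hv⟩
  · simp [hempty]
  have hsub : s ⊆ Metric.closedBall v (2 * L * r) := by
    intro u hu
    obtain ⟨hu1, hu2⟩ := hmem u hu
    obtain ⟨hv1, hv2⟩ := hmem v hv
    rw [Metric.mem_closedBall, dist_eq_norm]
    have h1 := h.antilipschitz u hu1 v hv1
    have h2 : ‖κ (φ.symm u) - κ (φ.symm v)‖ ≤ 2 * r := by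
      have := norm_sub_le (κ x - κ (φ.symm v)) (κ x - κ (φ.symm u))
      rw [sub_sub_sub_cancel_left] at this
      linarith
    nlinarith [h.lipschitz_pos]
  calc ∫⁻ u in s, ENNReal.ofReal (volumeDensity ι φ u)
      ≤ ∫⁻ _ in s, ENNReal.ofReal b :=
        setLIntegral_mono' hs_meas fun u hu =>
          ENNReal.ofReal_le_ofReal (h.density_le u (hmem u hu).1)
    _ = ENNReal.ofReal b * volume s := setLIntegral_const _ _
    _ ≤ ENNReal.ofReal b * volume (Metric.closedBall v (2 * L * r)) := by gcongr
    _ = _ := by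
      have hL := h.lipschitz_pos
      have hb := h.upper_pos
      rw [Measure.addHaar_closedBall _ _ (by positivity), finrank_euclideanSpace_fin,
        ← ofReal_measureReal (measure_ball_lt_top.ne),
        ← ENNReal.ofReal_mul (by positivity), ← ENNReal.ofReal_mul hb.le]
      congr 1
      ring

theorem le_chartVolume [MeasurableSpace M] [BorelSpace M] (h : IsGoodChart ι κ φ u₀ ρ L a b)
    (hκ : Continuous κ) {x : M} (hx : x ∈ φ.source ∩ φ ⁻¹' Metric.ball u₀ ρ) {r : ℝ} (hr : 0 < r)
    (hrρ : r ≤ L * ρ) :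
    ENNReal.ofReal (a * ((1 / L) ^ d *
        volume.real (Metric.ball (0 : EuclideanSpace ℝ (Fin d)) 1)) * r ^ d) ≤
      chartVolume ι φ (extrinsicBall κ x r) := by
  have hL := h.lipschitz_pos
  have ha := h.lower_pos
  rw [chartVolume_apply ι φ (measurableSet_extrinsicBall hκ x r)]
  have hball : Metric.ball (φ x) (r / L) ⊆ Metric.ball u₀ (2 * ρ) := by
    refine Metric.ball_subset_ball' ?_
    have h1 : r / L ≤ ρ := by rw [div_le_iff₀ hL]; linarith
    have h2 : dist (φ x) u₀ < ρ := hx.2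
    linarith
  have hsub : Metric.ball (φ x) (r / L) ⊆ φ.symm ⁻¹' extrinsicBall κ x r ∩ φ.target := by
    intro u hu
    refine ⟨?_, h.ball_subset (hball hu)⟩
    have h1 := h.lipschitz (φ x) (h.ball_subset_ball hx.2) u (hball hu)
    rw [φ.left_inv hx.1] at h1
    have h2 : ‖φ x - u‖ ≤ r / L := by
      rw [← dist_eq_norm, dist_comm]; exact (Metric.mem_ball.1 hu).le
    calc ‖κ x - κ (φ.symm u)‖ ≤ L * ‖φ x - u‖ := h1
      _ ≤ L * (r / L) := by gcongr
      _ = r := by field_simp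
  calc ENNReal.ofReal (a * ((1 / L) ^ d *
        volume.real (Metric.ball (0 : EuclideanSpace ℝ (Fin d)) 1)) * r ^ d)
      = ENNReal.ofReal a * volume (Metric.ball (φ x) (r / L)) := by
        rw [Measure.addHaar_ball_of_pos _ _ (by positivity), finrank_euclideanSpace_fin,
          ← ofReal_measureReal (measure_ball_lt_top.ne),
          ← ENNReal.ofReal_mul (by positivity), ← ENNReal.ofReal_mul ha.le]
        congr 1
        rw [div_pow, div_pow]
        ring
    _ = ∫⁻ _ in Metric.ball (φ x) (r / L), ENNReal.ofReal a := (setLIntegral_const _ _).symm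
    _ ≤ ∫⁻ u in Metric.ball (φ x) (r / L), ENNReal.ofReal (volumeDensity ι φ u) :=
        setLIntegral_mono' measurableSet_ball fun u hu =>
          ENNReal.ofReal_le_ofReal (h.le_density u (hball hu))
    _ ≤ _ := lintegral_mono_set hsub

end IsGoodChart

variable [ChartedSpace (EuclideanSpace ℝ (Fin d)) M] [IsManifold (𝓡 d) 1 M]

theorem exists_isGoodChart {n : ℕ∞ω} (hn : 1 ≤ n)
    {ι : M → EuclideanSpace ℝ (Fin p)} {κ : M → EuclideanSpace ℝ (Fin p')}
    (hι : Manifold.IsSmoothEmbedding (𝓡 d) 𝓘(ℝ, EuclideanSpace ℝ (Fin p)) n ι)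
    (hκ : Manifold.IsSmoothEmbedding (𝓡 d) 𝓘(ℝ, EuclideanSpace ℝ (Fin p')) n κ) (x₀ : M) :
    ∃ ρ L a b, IsGoodChart ι κ (chartAt (EuclideanSpace ℝ (Fin d)) x₀)
      (chartAt (EuclideanSpace ℝ (Fin d)) x₀ x₀) ρ L a b := by
  obtain ⟨L, hL, s, hs, hLs⟩ := exists_biLipschitz_of_isImmersionAt hn (hκ.contMDiff.of_le hn)
    (hκ.isImmersion.isImmersionAt x₀)
  obtain ⟨a, ha, b, hb, hab⟩ := exists_volumeDensity_bounds hn (hι.contMDiff.of_le hn)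
    (hι.isImmersion.isImmersionAt x₀)
  have htarget := (chartAt (EuclideanSpace ℝ (Fin d)) x₀).open_target.mem_nhds
    (mem_chart_target _ x₀)
  obtain ⟨ρ, hρ, hball⟩ := Metric.mem_nhds_iff.1 (inter_mem (inter_mem hs hab) htarget)
  refine ⟨ρ / 2, L, a, b, by positivity, hL, ha, hb, ?_, ?_, ?_, ?_, ?_⟩ <;>
    rw [mul_div_cancel₀ _ two_ne_zero]
  · exact fun u hu => (hball hu).2
  · exact fun u hu v hv => (hLs u (hball hu).1.1 v (hball hv).1.1).1
  · exact fun u hu v hv => (hLs u (hball hu).1.1 v (hball hv).1.1).2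
  · exact fun u hu => (hball hu).1.2.1
  · exact fun u hu => (hball hu).1.2.2

/-- The volume is dominated by the sum of the volumes of any finite family of charts, each cut off
to a piece of its domain, as soon as the pieces cover `M`. -/
theorem riemannianVolume_le_sum [MeasurableSpace M] [BorelSpace M]
    {ι : M → EuclideanSpace ℝ (Fin p)}
    (hι : ContMDiff (𝓡 d) 𝓘(ℝ, EuclideanSpace ℝ (Fin p)) 1 ι) (t : Finset M) (N : M → Set M)
    (hN : ∀ x, N x ⊆ (chartAt (EuclideanSpace ℝ (Fin d)) x).source)
    (hN_meas : ∀ x, MeasurableSet (N x)) (hcover : ⋃ x ∈ t, N x = Set.univ)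
    {S : Set M} (hS : MeasurableSet S) :
    riemannianVolume (d := d) ι S ≤
      ∑ x ∈ t, chartVolume ι (chartAt (EuclideanSpace ℝ (Fin d)) x) (S ∩ N x) := by
  set Λ : Measure M :=
    ∑ x ∈ t, (chartVolume ι (chartAt (EuclideanSpace ℝ (Fin d)) x)).restrict (N x) with hΛ
  have hΛ_apply : ∀ {S : Set M}, MeasurableSet S →
      Λ S = ∑ x ∈ t, chartVolume ι (chartAt (EuclideanSpace ℝ (Fin d)) x) (S ∩ N x) := by
    intro S hS
    simp [hΛ, Measure.finsetSum_apply, Measure.restrict_apply hS]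
  rw [← hΛ_apply hS]
  suffices h : riemannianVolume (d := d) ι ≤ Λ from h S
  refine iSup₂_le fun φ hφ => Measure.le_iff.2 fun A hA => ?_
  rw [hΛ_apply hA]
  calc chartVolume ι φ A = chartVolume ι φ (⋃ x ∈ t, A ∩ N x) := by
        rw [← Set.inter_iUnion₂, hcover, Set.inter_univ]
    _ ≤ ∑ x ∈ t, chartVolume ι φ (A ∩ N x) := measure_biUnion_finset_le _ _
    _ ≤ _ := Finset.sum_le_sum fun x _ => by
        have h1 : A ∩ N x = (A ∩ N x) ∩ (chartAt (EuclideanSpace ℝ (Fin d)) x).source :=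
          (Set.inter_eq_left.2 (Set.inter_subset_right.trans (hN x))).symm
        nth_rewrite 1 [h1]
        exact chartVolume_inter_source_le hι (IsManifold.subset_maximalAtlas hφ)
          (IsManifold.subset_maximalAtlas (chart_mem_atlas _ x)) (hA.inter (hN_meas x))

/-- On a compact manifold, the extrinsic balls of one embedding have volume of order `r ^ d` for the
metric induced by another. -/
theorem riemannianVolume_extrinsicBall [CompactSpace M] [MeasurableSpace M] [BorelSpace M]
    {n : ℕ∞ω} (hn : 1 ≤ n)
    {ι : M → EuclideanSpace ℝ (Fin p)} {κ : M → EuclideanSpace ℝ (Fin p')}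
    (hι : Manifold.IsSmoothEmbedding (𝓡 d) 𝓘(ℝ, EuclideanSpace ℝ (Fin p)) n ι)
    (hκ : Manifold.IsSmoothEmbedding (𝓡 d) 𝓘(ℝ, EuclideanSpace ℝ (Fin p')) n κ) :
    ∃ c > 0, ∃ C > 0, ∃ r₀ > 0, ∀ x r, 0 < r →
      riemannianVolume (d := d) ι (extrinsicBall κ x r) ≤ ENNReal.ofReal (C * r ^ d) ∧
      (r ≤ r₀ →
        ENNReal.ofReal (c * r ^ d) ≤ riemannianVolume (d := d) ι (extrinsicBall κ x r)) := by
  choose ρ L a b hgood using exists_isGoodChart (d := d) hn hι hκ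
  set ch : M → OpenPartialHomeomorph M (EuclideanSpace ℝ (Fin d)) :=
    fun x => chartAt (EuclideanSpace ℝ (Fin d)) x with hch
  set N : M → Set M := fun x => (ch x).source ∩ ch x ⁻¹' Metric.ball (ch x x) (ρ x) with hN
  have hκc : Continuous κ := hκ.contMDiff.continuous
  have hNopen : ∀ x, IsOpen (N x) := fun x => (ch x).isOpen_inter_preimage Metric.isOpen_ball
  have hNnhds : ∀ x, N x ∈ 𝓝 x := fun x => (hNopen x).mem_nhds
    ⟨mem_chart_source _ x, Metric.mem_ball_self (hgood x).radius_pos⟩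
  obtain ⟨t, ht⟩ := CompactSpace.elim_nhds_subcover N hNnhds
  have ht' : ⋃ x ∈ t, N x = Set.univ := ht
  set v₁ := volume.real (Metric.ball (0 : EuclideanSpace ℝ (Fin d)) 1) with hv₁
  have hv₁pos : 0 < v₁ := 
    ENNReal.toReal_pos (Metric.measure_ball_pos _ _ one_pos).ne' measure_ball_lt_top.ne
  -- a positive lower bound for finitely many positive numbers
  have hmin : ∀ g : M → ℝ, (∀ x, 0 < g x) → ∃ m > 0, ∀ x ∈ t, m ≤ g x := by
    intro g hg
    rcases t.eq_empty_or_nonempty with rfl | hne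
    · exact ⟨1, one_pos, by simp⟩
    · obtain ⟨x, hx, hmin⟩ := t.exists_min_image g hne
      exact ⟨g x, hg x, hmin⟩
  obtain ⟨c, hc, hc_le⟩ := hmin (fun x => a x * ((1 / L x) ^ d * v₁)) fun x => by
    have := (hgood x).lipschitz_pos; have := (hgood x).lower_pos; positivity
  obtain ⟨r₀, hr₀, hr₀_le⟩ := hmin (fun x => L x * ρ x) fun x =>
    mul_pos (hgood x).lipschitz_pos (hgood x).radius_pos
  have hupper : ∀ x, 0 ≤ b x * ((2 * L x) ^ d * v₁) := fun x => by
    have := (hgood x).lipschitz_pos; have := (hgood x).upper_pos; positivity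
  have hsum : 0 ≤ ∑ x ∈ t, b x * ((2 * L x) ^ d * v₁) := Finset.sum_nonneg fun x _ => hupper x
  refine ⟨c, hc, ∑ x ∈ t, b x * ((2 * L x) ^ d * v₁) + 1, by positivity, r₀, hr₀, ?_⟩
  intro x r hr
  refine ⟨?_, fun hrr => ?_⟩
  · calc riemannianVolume (d := d) ι (extrinsicBall κ x r)
        ≤ ∑ y ∈ t, chartVolume ι (ch y) (extrinsicBall κ x r ∩ N y) :=
          riemannianVolume_le_sum (hι.contMDiff.of_le hn) t N (fun _ => Set.inter_subset_left)
            (fun y => (hNopen y).measurableSet) ht' (measurableSet_extrinsicBall hκc x r)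
      _ ≤ ∑ y ∈ t, ENNReal.ofReal (b y * ((2 * L y) ^ d * v₁) * r ^ d) :=
          Finset.sum_le_sum fun y _ => (hgood y).chartVolume_le hκc x hr
      _ = ENNReal.ofReal ((∑ y ∈ t, b y * ((2 * L y) ^ d * v₁)) * r ^ d) := by
          rw [Finset.sum_mul, ENNReal.ofReal_sum_of_nonneg]
          exact fun y _ => mul_nonneg (hupper y) (by positivity)
      _ ≤ _ := by
          apply ENNReal.ofReal_le_ofReal
          have : 0 ≤ r ^ d := by positivity
          nlinarith
  · have hx : x ∈ ⋃ y ∈ t, N y := ht' ▸ Set.mem_univ x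
    obtain ⟨y, hy, hxy⟩ := Set.mem_iUnion₂.1 hx
    calc ENNReal.ofReal (c * r ^ d)
        ≤ ENNReal.ofReal (a y * ((1 / L y) ^ d * v₁) * r ^ d) := by
          apply ENNReal.ofReal_le_ofReal
          have := hc_le y hy
          gcongr
      _ ≤ chartVolume ι (ch y) (extrinsicBall κ x r) :=
          (hgood y).le_chartVolume hκc hxy hr (hrr.trans (hr₀_le y hy))
      _ ≤ riemannianVolume (d := d) ι (extrinsicBall κ x r) :=
          (le_iSup₂ (f := fun (φ : OpenPartialHomeomorph M (EuclideanSpace ℝ (Fin d)))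
            (_ : φ ∈ atlas (EuclideanSpace ℝ (Fin d)) M) => chartVolume ι φ) (ch y)
              (chart_mem_atlas _ y)) _

end Balls

/-! ### A Bernstein inequality -/

section Bernstein

variable {Ω : Type*} [MeasurableSpace Ω] {P : Measure Ω} [IsProbabilityMeasure P]

/-- From `exp u ≤ 1 + u + u²` for `|u| ≤ 1`. -/
theorem mgf_le_exp_of_bounded {Y : Ω → ℝ} (hY : Measurable Y) {b v s : ℝ} (hb : ∀ w, |Y w| ≤ b)
    (h0 : ∫ w, Y w ∂P = 0) (hv : ∫ w, Y w ^ 2 ∂P ≤ v) (hs : |s| * b ≤ 1) :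
    mgf Y P s ≤ Real.exp (s ^ 2 * v) := by
  have hYint : Integrable Y P :=
    Integrable.of_bound hY.aestronglyMeasurable b (ae_of_all _ hb)
  have hY2int : Integrable (fun w => Y w ^ 2) P := by
    refine Integrable.of_bound (hY.pow_const 2).aestronglyMeasurable (b ^ 2)
      (ae_of_all _ fun w => ?_)
    rw [Real.norm_eq_abs, abs_pow]
    exact pow_le_pow_left₀ (abs_nonneg _) (hb w) 2
  have hpt : ∀ w, Real.exp (s * Y w) ≤ 1 + s * Y w + s ^ 2 * Y w ^ 2 := by
    intro w
    have habs : |s * Y w| ≤ 1 := by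
      rw [abs_mul]
      exact (mul_le_mul_of_nonneg_left (hb w) (abs_nonneg s)).trans hs
    have := (abs_le.1 (Real.abs_exp_sub_one_sub_id_le habs)).2
    rw [mul_pow] at this
    linarith
  have hlin : Integrable (fun w => 1 + s * Y w) P := (integrable_const _).add (hYint.const_mul s)
  have hint : Integrable (fun w => 1 + s * Y w + s ^ 2 * Y w ^ 2) P :=
    hlin.add (hY2int.const_mul (s ^ 2))
  calc mgf Y P s ≤ ∫ w, (1 + s * Y w + s ^ 2 * Y w ^ 2) ∂P :=
        integral_mono_of_nonneg (ae_of_all _ fun w => (Real.exp_pos _).le) hint (ae_of_all _ hpt)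
    _ = 1 + s ^ 2 * ∫ w, Y w ^ 2 ∂P := by
        rw [integral_add hlin (hY2int.const_mul _),
          integral_add (integrable_const _) (hYint.const_mul s), integral_const_mul,
          integral_const_mul, h0]
        simp
    _ ≤ 1 + s ^ 2 * v := by gcongr
    _ ≤ Real.exp (s ^ 2 * v) := by
        have := Real.add_one_le_exp (s ^ 2 * v)
        linarith

variable {N : ℕ} {Y : Fin N → Ω → ℝ}

theorem measureReal_le_sum_le_exp (hind : iIndepFun Y P) (hY : ∀ i, Measurable (Y i)) {b v t : ℝ}
    (hb : ∀ i w, |Y i w| ≤ b) (h0 : ∀ i, ∫ w, Y i w ∂P = 0) (hv : ∀ i, ∫ w, Y i w ^ 2 ∂P ≤ v)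
    (hvpos : 0 < v) (ht : 0 ≤ t) (htb : t * b ≤ 2 * v) :
    P.real {w | N * t ≤ ∑ i, Y i w} ≤ Real.exp (-(N * t ^ 2 / (4 * v))) := by
  -- the minimizer of `-s t + s² v`, at which `mgf_le_exp_of_bounded` applies because `t b ≤ 2 v`
  set s := t / (2 * v) with hs
  have hs0 : 0 ≤ s := by positivity
  have hsb : |s| * b ≤ 1 := by
    rw [abs_of_nonneg hs0, hs, div_mul_eq_mul_div, div_le_one (by positivity)]
    exact htb
  have hmgf : mgf (∑ i, Y i) P s ≤ Real.exp (N * (s ^ 2 * v)) := by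
    rw [hind.mgf_sum hY]
    calc ∏ i, mgf (Y i) P s ≤ ∏ _i : Fin N, Real.exp (s ^ 2 * v) :=
          Finset.prod_le_prod (fun i _ => mgf_nonneg)
            fun i _ => mgf_le_exp_of_bounded (hY i) (hb i) (h0 i) (hv i) hsb
      _ = Real.exp (N * (s ^ 2 * v)) := by
          rw [Finset.prod_const, Finset.card_univ, Fintype.card_fin, ← Real.exp_nat_mul]
  have hint : Integrable (fun w => Real.exp (s * (∑ i, Y i) w)) P := by
    have hsum : Measurable (∑ i, Y i) := by fun_prop
    refine Integrable.of_bound (Real.measurable_exp.comp (hsum.const_mul s)).aestronglyMeasurable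
      (Real.exp (s * (N * b))) (ae_of_all _ fun w => ?_)
    rw [Real.norm_eq_abs, Real.abs_exp, Real.exp_le_exp, Finset.sum_apply]
    refine mul_le_mul_of_nonneg_left ?_ hs0
    calc ∑ i, Y i w ≤ ∑ _i : Fin N, b := Finset.sum_le_sum fun i _ => (le_abs_self _).trans (hb i w)
      _ = N * b := by simp
  have h := measure_ge_le_exp_mul_mgf (μ := P) (X := ∑ i, Y i) (N * t) hs0 hint
  simp only [Finset.sum_apply] at h
  refine h.trans ((mul_le_mul_of_nonneg_left hmgf (Real.exp_pos _).le).trans ?_)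
  rw [← Real.exp_add, Real.exp_le_exp, hs]
  refine le_of_eq ?_
  field_simp
  ring

/-- **Bernstein's inequality**, in the range of deviations where the variance dominates. -/
theorem measureReal_abs_sum_le_exp (hind : iIndepFun Y P) (hY : ∀ i, Measurable (Y i)) {b v t : ℝ}
    (hb : ∀ i w, |Y i w| ≤ b) (h0 : ∀ i, ∫ w, Y i w ∂P = 0) (hv : ∀ i, ∫ w, Y i w ^ 2 ∂P ≤ v)
    (hvpos : 0 < v) (ht : 0 ≤ t) (htb : t * b ≤ 2 * v) :
    P.real {w | N * t ≤ |∑ i, Y i w|} ≤ 2 * Real.exp (-(N * t ^ 2 / (4 * v))) := by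
  have h1 := measureReal_le_sum_le_exp hind hY hb h0 hv hvpos ht htb
  have h2 := measureReal_le_sum_le_exp (Y := fun i w => -Y i w)
    (hind.comp (fun _ x => -x) fun _ => measurable_neg) (fun i => (hY i).neg)
    (b := b) (v := v) (t := t) (by simpa using hb) (fun i => by simp [integral_neg, h0 i])
    (by simpa using hv) hvpos ht htb
  have hsub : {w | N * t ≤ |∑ i, Y i w|} ⊆
      {w | N * t ≤ ∑ i, Y i w} ∪ {w | N * t ≤ ∑ i, -Y i w} := by
    intro w hw
    rcases le_abs.1 (show N * t ≤ |∑ i, Y i w| from hw) with h | h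
    · exact Or.inl h
    · exact Or.inr (by simpa [Finset.sum_neg_distrib] using h)
  calc _ ≤ P.real ({w | N * t ≤ ∑ i, Y i w} ∪ {w | N * t ≤ ∑ i, -Y i w}) := measureReal_mono hsub
    _ ≤ _ := measureReal_union_le _ _
    _ ≤ _ := by linarith

end Bernstein

/-! ### Deviations of empirical averages at random points -/

section Deviation

theorem indepFun_of_iIndepFun_sumElim {Ω S : Type*} [MeasurableSpace Ω] [MeasurableSpace S]
    {P : Measure Ω} {X Z : ℕ → Ω → S} (h : iIndepFun (Sum.elim X Z : ℕ ⊕ ℕ → Ω → S) P)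
    (hX : ∀ i, Measurable (X i)) (hZ : ∀ k, Measurable (Z k)) (i N : ℕ) :
    IndepFun (X i) (fun w (k : Fin N) => Z k w) P := by
  classical
  have hmeas : ∀ j, Measurable (Sum.elim X Z j) := by rintro (j | j); exacts [hX j, hZ j]
  set I : Finset (ℕ ⊕ ℕ) := {Sum.inl i}
  set J : Finset (ℕ ⊕ ℕ) := Finset.univ.image fun k : Fin N => Sum.inr (k : ℕ)
  have hIJ : Disjoint I J := by
    simp [I, J]
  have := h.indepFun_finset I J hIJ hmeas
  have hI : Sum.inl i ∈ I := by simp [I]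
  have hJ : ∀ k : Fin N, Sum.inr (k : ℕ) ∈ J := fun k => by simp [J]
  have hφ : Measurable fun u : I → S => u ⟨Sum.inl i, hI⟩ := measurable_pi_apply _
  have hψ : Measurable fun (u : J → S) (k : Fin N) => u ⟨Sum.inr (k : ℕ), hJ k⟩ :=
    measurable_pi_lambda _ fun k => measurable_pi_apply _
  exact this.comp hφ hψ

theorem iIndepFun_sumElim_swap {Ω S : Type*} [MeasurableSpace Ω] [MeasurableSpace S]
    {P : Measure Ω} {X Z : ℕ → Ω → S} (h : iIndepFun (Sum.elim X Z : ℕ ⊕ ℕ → Ω → S) P) :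
    iIndepFun (Sum.elim Z X : ℕ ⊕ ℕ → Ω → S) P := by
  have := h.precomp (Equiv.sumComm ℕ ℕ).injective
  convert this using 1
  ext j w
  rcases j with j | j <;> rfl

variable {Ω S T : Type*} [MeasurableSpace Ω] [MeasurableSpace S] [MeasurableSpace T]
  {P : Measure Ω} [IsProbabilityMeasure P]

/-- The empirical average of `g` over `y`. -/
noncomputable def average {N : ℕ} (g : T → ℝ) (y : Fin N → T) : ℝ := (∑ k, g (y k)) / N

variable {μ : Measure T} {N : ℕ} {Y : Fin N → Ω → T}

theorem measureReal_deviation_le (hind : iIndepFun Y P) (hY : ∀ k, Measurable (Y k))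
    (hlaw : ∀ k, P.map (Y k) = μ) {g : T → ℝ} (hg : Measurable g) {B v t : ℝ}
    (hB : ∀ y, |g y| ≤ B) (hv : ∫ y, g y ^ 2 ∂μ ≤ v) (hvpos : 0 < v) (ht : 0 ≤ t)
    (htB : t * B ≤ v) :
    P.real {w | t < |average g (fun k => Y k w) - ∫ y, g y ∂μ|} ≤
      2 * Real.exp (-(N * t ^ 2 / (4 * v))) := by
  rcases Nat.eq_zero_or_pos N with rfl | hN
  · refine measureReal_le_one.trans ?_
    norm_num
  have hμ : IsProbabilityMeasure μ := by
    rw [← hlaw ⟨0, hN⟩]; exact Measure.isProbabilityMeasure_map (hY _).aemeasurable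
  set E := ∫ y, g y ∂μ with hE
  have hgint : Integrable g μ := Integrable.of_bound hg.aestronglyMeasurable B (ae_of_all _ hB)
  have hg2int : Integrable (fun y => g y ^ 2) μ := by
    refine Integrable.of_bound (hg.pow_const 2).aestronglyMeasurable (B ^ 2)
      (ae_of_all _ fun w => ?_)
    rw [Real.norm_eq_abs, abs_pow]
    exact pow_le_pow_left₀ (abs_nonneg _) (hB w) 2
  have hEB : |E| ≤ B := by
    have := norm_integral_le_of_norm_le_const (μ := μ) (f := g) (ae_of_all _ hB)
    simpa using this
  have hpush : ∀ (k : Fin N) (f : T → ℝ), Measurable f →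
      ∫ w, f (Y k w) ∂P = ∫ y, f y ∂μ := by
    intro k f hf
    rw [← hlaw k, integral_map (hY k).aemeasurable hf.aestronglyMeasurable]
  have hvar : ∫ y, (g y - E) ^ 2 ∂μ ≤ v := by
    have : ∫ y, (g y - E) ^ 2 ∂μ = ∫ y, g y ^ 2 ∂μ - E ^ 2 := by
      have h1 : (fun y => (g y - E) ^ 2) = fun y => g y ^ 2 - (2 * E * g y - E ^ 2) := by
        ext y; ring
      have h2 : Integrable (fun y => 2 * E * g y - E ^ 2) μ :=
        (hgint.const_mul _).sub (integrable_const _)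
      rw [h1, integral_sub hg2int h2,
        integral_sub (hgint.const_mul _) (integrable_const _), integral_const_mul, ← hE]
      simp
      ring
    rw [this]
    have := sq_nonneg E
    linarith
  have hdev := measureReal_abs_sum_le_exp (P := P) (Y := fun k w => g (Y k w) - E)
    (hind.comp (fun _ y => g y - E) fun _ => hg.sub_const E)
    (fun k => (hg.comp (hY k)).sub_const E) (b := 2 * B) (v := v) (t := t)
    (fun k w => by
      have := abs_sub (g (Y k w)) E
      have := hB (Y k w)
      linarith)
    (fun k => by
      rw [hpush k (fun y => g y - E) (hg.sub_const E), integral_sub hgint (integrable_const _)]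
      simp [hE])
    (fun k => by rw [hpush k (fun y => (g y - E) ^ 2) ((hg.sub_const E).pow_const 2)]; exact hvar)
    hvpos ht (by linarith)
  refine (measureReal_mono ?_).trans hdev
  intro w hw
  have hw' : t < |average g (fun k => Y k w) - E| := hw
  have hNpos : (0 : ℝ) < N := by exact_mod_cast hN
  have : ∑ k, (g (Y k w) - E) = N * (average g (fun k => Y k w) - E) := by
    rw [Finset.sum_sub_distrib]
    simp only [average, Finset.sum_const, Finset.card_univ, Fintype.card_fin, nsmul_eq_mul]
    field_simp
  show N * t ≤ |∑ k, (g (Y k w) - E)|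
  rw [this, abs_mul, abs_of_pos hNpos]
  gcongr

/-- The same bound for an integrand that depends on a random point independent of the sample:
condition on the point. -/
theorem measureReal_deviation_at_random_point_le {W : Ω → S} (hW : Measurable W)
    (hind : iIndepFun Y P) (hY : ∀ k, Measurable (Y k)) (hlaw : ∀ k, P.map (Y k) = μ)
    [SFinite μ] (hWY : IndepFun W (fun w k => Y k w) P) {h : S → T → ℝ}
    (hh : Measurable (Function.uncurry h)) {B v t : ℝ} (hB : ∀ x y, |h x y| ≤ B)
    (hv : ∀ x, ∫ y, h x y ^ 2 ∂μ ≤ v) (hvpos : 0 < v) (ht : 0 ≤ t) (htB : t * B ≤ v) :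
    P.real {w | t < |average (h (W w)) (fun k => Y k w) - ∫ y, h (W w) y ∂μ|} ≤
      2 * Real.exp (-(N * t ^ 2 / (4 * v))) := by
  set q := 2 * Real.exp (-(N * t ^ 2 / (4 * v))) with hq
  have hYm : Measurable (fun w k => Y k w) := measurable_pi_lambda _ hY
  set A : Set (S × (Fin N → T)) :=
    {z | t < |average (h z.1) z.2 - ∫ y, h z.1 y ∂μ|} with hA
  have hA_meas : MeasurableSet A := by
    refine measurableSet_lt measurable_const (Measurable.abs (Measurable.sub ?_ ?_))
    · refine Measurable.div_const (Finset.univ.measurable_fun_sum fun k _ => ?_) _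
      exact hh.comp (measurable_fst.prodMk ((measurable_pi_apply k).comp measurable_snd))
    · exact (hh.stronglyMeasurable.integral_prod_right (ν := μ)).measurable.comp measurable_fst
  have hprod := (indepFun_iff_map_prod_eq_prod_map_map hW.aemeasurable hYm.aemeasurable).1 hWY
  have hWprob : IsProbabilityMeasure (P.map W) := Measure.isProbabilityMeasure_map hW.aemeasurable
  have hYprob : IsProbabilityMeasure (P.map fun w k => Y k w) :=
    Measure.isProbabilityMeasure_map hYm.aemeasurable
  have hsection : ∀ x, (P.map fun w k => Y k w) (Prod.mk x ⁻¹' A) ≤ ENNReal.ofReal q := by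
    intro x
    rw [Measure.map_apply hYm (measurable_prodMk_left hA_meas)]
    refine ENNReal.le_ofReal_iff_toReal_le (measure_ne_top _ _) (by positivity) |>.2 ?_
    exact measureReal_deviation_le hind hY hlaw (hh.comp measurable_prodMk_left) (hB x) (hv x)
      hvpos ht htB
  have hbound : P ((fun w => (W w, fun k => Y k w)) ⁻¹' A) ≤ ENNReal.ofReal q := by
    rw [← Measure.map_apply (hW.prodMk hYm) hA_meas, hprod, Measure.prod_apply hA_meas]
    calc ∫⁻ x, (P.map fun w k => Y k w) (Prod.mk x ⁻¹' A) ∂P.map W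
        ≤ ∫⁻ _, ENNReal.ofReal q ∂P.map W := lintegral_mono hsection
      _ = ENNReal.ofReal q := by simp
  exact ENNReal.toReal_le_of_le_ofReal (by positivity) hbound

variable {ν : Measure S} {X : ℕ → Ω → S} {Z : ℕ → Ω → S}

/-- Uniform deviation bound: averages over the first `N` of the `Z`'s, at the first `n` of the
`X`'s. -/
theorem measureReal_exists_deviation_le {μ : Measure S} [SFinite μ]
    (hind : iIndepFun (Sum.elim X Z : ℕ ⊕ ℕ → Ω → S) P)
    (hX : ∀ i, Measurable (X i)) (hZ : ∀ k, Measurable (Z k)) (hlaw : ∀ k, P.map (Z k) = μ)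
    {h : S → S → ℝ} (hh : Measurable (Function.uncurry h)) {B v t : ℝ} (hB : ∀ x y, |h x y| ≤ B)
    (hv : ∀ x, ∫ y, h x y ^ 2 ∂μ ≤ v) (hvpos : 0 < v) (ht : 0 ≤ t) (htB : t * B ≤ v) (n N : ℕ) :
    P.real {w | ∃ i : Fin n, t < |average (h (X i w)) (fun k : Fin N => Z k w) -
        ∫ y, h (X i w) y ∂μ|} ≤
      n * (2 * Real.exp (-(N * t ^ 2 / (4 * v)))) := by
  have hZind : iIndepFun (fun k : Fin N => Z k) P :=
    hind.precomp (g := fun k : Fin N => Sum.inr (k : ℕ))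
      (Sum.inr_injective.comp Fin.val_injective)
  have hset : {w | ∃ i : Fin n, t < |average (h (X i w)) (fun k : Fin N => Z k w) -
        ∫ y, h (X i w) y ∂μ|} = ⋃ i : Fin n, {w | t < |average (h (X i w))
          (fun k : Fin N => Z k w) - ∫ y, h (X i w) y ∂μ|} := by
    ext w; simp
  rw [hset]
  refine (measureReal_iUnion_fintype_le _).trans ?_
  calc _ ≤ ∑ _i : Fin n, 2 * Real.exp (-(N * t ^ 2 / (4 * v))) :=
        Finset.sum_le_sum fun i _ => measureReal_deviation_at_random_point_le (hX i) hZind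
          (fun k => hZ k) (fun k => hlaw k) (indepFun_of_iIndepFun_sumElim hind hX hZ i N) hh hB hv
          hvpos ht htB
    _ = _ := by simp

end Deviation

/-! ### The matrix and the operator as ratios of averages -/

section Average

variable {T : Type*} {N : ℕ}

theorem average_const_mul (c : ℝ) (g : T → ℝ) (y : Fin N → T) :
    average (fun t => c * g t) y = c * average g y := by
  simp [average, ← Finset.mul_sum, mul_div_assoc]

theorem average_pos {g : T → ℝ} {y : Fin N → T} (hN : 0 < N) (h : ∀ k, 0 < g (y k)) :
    0 < average g y := by
  have : Nonempty (Fin N) := ⟨⟨0, hN⟩⟩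
  exact div_pos (Finset.sum_pos (fun k _ => h k) Finset.univ_nonempty) (by exact_mod_cast hN)

theorem abs_average_sub_le {g g' w : T → ℝ} {y : Fin N → T} {τ : ℝ}
    (h : ∀ k, |g (y k) - g' (y k)| ≤ τ * w (y k)) :
    |average g y - average g' y| ≤ τ * average w y := by
  rw [← average_const_mul]
  unfold average
  rw [← sub_div, ← Finset.sum_sub_distrib, abs_div, Nat.abs_cast]
  exact div_le_div_of_nonneg_right
    ((Finset.abs_sum_le_sum_abs _ _).trans (Finset.sum_le_sum fun k _ => h k)) (Nat.cast_nonneg N)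

theorem sum_eq_mul_average (hN : 0 < N) (g : T → ℝ) (y : Fin N → T) :
    ∑ k, g (y k) = N * average g y := by
  have : (N : ℝ) ≠ 0 := by positivity
  unfold average
  field_simp

end Average

section Empirical

variable {M : Type*} {n m : ℕ}

/-- The empirical counterpart of the landmark degree function. -/
noncomputable def empiricalDegree (k₂ : M → M → ℝ) (x : Fin n → M) (z : Fin m → M) (ζ : M) : ℝ :=
  average (fun y => k₂ ζ y * average (k₂ y) z) x

/-- The empirical counterpart of `N f x = ∫ k₁(x, ζ) d(ζ)^(-α) (∫ k₂(ζ, y) f(y) dν(y)) dν_Z(ζ)`. -/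
noncomputable def empiricalNumerator (k₁ k₂ : M → M → ℝ) (α : ℝ) (x : Fin n → M) (z : Fin m → M)
    (f : M → ℝ) (ξ : M) : ℝ :=
  average (fun ζ => k₁ ξ ζ * (empiricalDegree k₂ x z ζ ^ (-α) *
    average (fun y => k₂ ζ y * f y) x)) z

variable {k₁ k₂ : M → M → ℝ} {α : ℝ} {x : Fin n → M} {z : Fin m → M}

theorem empiricalDegree_pos (h₂ : ∀ x y, 0 < k₂ x y) (hn : 0 < n) (hm : 0 < m) (ζ : M) :
    0 < empiricalDegree k₂ x z ζ :=
  average_pos hn fun _ => mul_pos (h₂ _ _) (average_pos hm fun _ => h₂ _ _)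

theorem degreeTwo_eq (hsymm : ∀ x y, k₂ x y = k₂ y x) (hn : 0 < n) (hm : 0 < m) (k : Fin m) :
    degreeTwo k₂ x z k = (n * m) * empiricalDegree k₂ x z (z k) := by
  unfold degreeTwo empiricalDegree
  rw [mul_assoc, mul_comm (m : ℝ), ← mul_assoc, ← sum_eq_mul_average hn, Finset.sum_mul,
    ← Matrix.mulVec_mulVec]
  simp only [Matrix.mulVec, dotProduct, affinity, Matrix.transpose_apply, Matrix.of_apply,
    Pi.one_apply, mul_one]
  refine Finset.sum_congr rfl fun j _ => ?_
  rw [sum_eq_mul_average hm (k₂ (x j)), hsymm (x j) (z k)]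
  ring

theorem affinity_mul_diffusionTwo_mulVec (hsymm : ∀ x y, k₂ x y = k₂ y x)
    (h₂ : ∀ x y, 0 < k₂ x y) (hn : 0 < n) (hm : 0 < m) (f : M → ℝ) (i : Fin n) :
    ((affinity k₁ x z * (diffusionTwo k₂ α x z)ᵀ) *ᵥ fun j => f (x j)) i =
      ((n * m) * ((n : ℝ) * m) ^ (-α)) * empiricalNumerator k₁ k₂ α x z f (x i) := by
  have hnm : (0 : ℝ) ≤ n * m := by positivity
  unfold empiricalNumerator
  rw [mul_comm (n : ℝ) m, mul_assoc, mul_assoc, ← average_const_mul, ← average_const_mul,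
    ← sum_eq_mul_average hm, ← Matrix.mulVec_mulVec]
  simp only [Matrix.mulVec, dotProduct, affinity, Matrix.transpose_apply, Matrix.of_apply,
    diffusionTwo, Matrix.mul_diagonal]
  refine Finset.sum_congr rfl fun k _ => ?_
  rw [degreeTwo_eq hsymm hn hm k, Real.mul_rpow hnm (empiricalDegree_pos h₂ hn hm _).le]
  have : ∑ j, k₂ (x j) (z k) * (((n : ℝ) * m) ^ (-α) * empiricalDegree k₂ x z (z k) ^ (-α)) *
      f (x j) = (((n : ℝ) * m) ^ (-α) * empiricalDegree k₂ x z (z k) ^ (-α)) *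
        (n * average (fun y => k₂ (z k) y * f y) x) := by
    rw [← sum_eq_mul_average hn, Finset.mul_sum]
    refine Finset.sum_congr rfl fun j _ => ?_
    rw [hsymm (x j) (z k)]
    ring
  rw [this, mul_comm (m : ℝ) n]
  ring

theorem empiricalNumerator_one_pos (h₁ : ∀ x y, 0 < k₁ x y) (h₂ : ∀ x y, 0 < k₂ x y)
    (hn : 0 < n) (hm : 0 < m) (ξ : M) :
    0 < empiricalNumerator k₁ k₂ α x z (fun _ => 1) ξ :=
  average_pos hm fun _ => mul_pos (h₁ _ _) (mul_pos
    (Real.rpow_pos_of_pos (empiricalDegree_pos h₂ hn hm _) _)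
    (average_pos hn fun _ => by simpa using h₂ _ _))

/-- A row of the alternating diffusion matrix is a ratio of iterated averages; the powers of the
sample sizes cancel. -/
theorem ladMatrix_mulVec (hsymm : ∀ x y, k₂ x y = k₂ y x) (h₁ : ∀ x y, 0 < k₁ x y)
    (h₂ : ∀ x y, 0 < k₂ x y) (hm : 0 < m) (f : M → ℝ) (i : Fin n) :
    (ladMatrix k₁ k₂ α x z *ᵥ fun j => f (x j)) i =
      empiricalNumerator k₁ k₂ α x z f (x i) /
        empiricalNumerator k₁ k₂ α x z (fun _ => 1) (x i) := by
  have hn : 0 < n := i.pos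
  set A := affinity k₁ x z * (diffusionTwo k₂ α x z)ᵀ with hA
  have hconst : 0 < ((n : ℝ) * m) * ((n : ℝ) * m) ^ (-α) := by positivity
  have hdeg : ∀ i, (A *ᵥ 1) i = (((n : ℝ) * m) * ((n : ℝ) * m) ^ (-α)) *
      empiricalNumerator k₁ k₂ α x z (fun _ => 1) (x i) := fun i =>
    affinity_mul_diffusionTwo_mulVec hsymm h₂ hn hm (fun _ => 1) i
  have hne : ∀ i, (A *ᵥ 1) i ≠ 0 := fun i => by
    rw [hdeg i]; exact (mul_pos hconst (empiricalNumerator_one_pos h₁ h₂ hn hm _)).ne'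
  have hinv : (degreeOne k₁ k₂ α x z)⁻¹ = Matrix.diagonal fun i => ((A *ᵥ 1) i)⁻¹ := by
    refine Matrix.inv_eq_left_inv ?_
    unfold degreeOne
    rw [Matrix.diagonal_mul_diagonal, ← Matrix.diagonal_one]
    congr 1
    ext i
    exact inv_mul_cancel₀ (hne i)
  unfold ladMatrix diffusionOne
  rw [hinv, Matrix.mul_assoc, ← hA, ← Matrix.mulVec_mulVec, Matrix.mulVec_diagonal, hdeg, hA,
    affinity_mul_diffusionTwo_mulVec hsymm h₂ hn hm f i, ← div_eq_inv_mul,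
    mul_div_mul_left _ _ hconst.ne']

/-- The matrix does not change when both kernels are rescaled. -/
theorem ladMatrix_mulVec_const_mul {s : ℝ} (hs : 0 < s) (hsymm : ∀ x y, k₂ x y = k₂ y x)
    (h₁ : ∀ x y, 0 < k₁ x y) (h₂ : ∀ x y, 0 < k₂ x y) (hm : 0 < m) (f : M → ℝ) (i : Fin n) :
    (ladMatrix (fun x y => s * k₁ x y) (fun x y => s * k₂ x y) α x z *ᵥ fun j => f (x j)) i =
      (ladMatrix k₁ k₂ α x z *ᵥ fun j => f (x j)) i := by
  have hn : 0 < n := i.pos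
  have hdeg : ∀ ζ, empiricalDegree (fun x y => s * k₂ x y) x z ζ =
      s ^ 2 * empiricalDegree k₂ x z ζ := by
    intro ζ
    unfold empiricalDegree
    rw [← average_const_mul]
    congr 1
    ext y
    rw [average_const_mul]
    ring
  have hnum : ∀ g, empiricalNumerator (fun x y => s * k₁ x y) (fun x y => s * k₂ x y) α x z g
      (x i) =
      (s ^ 2 * (s ^ 2) ^ (-α)) * empiricalNumerator k₁ k₂ α x z g (x i) := by
    intro g
    unfold empiricalNumerator
    rw [← average_const_mul]
    congr 1
    ext ζ
    rw [hdeg, Real.mul_rpow (by positivity) (empiricalDegree_pos h₂ hn hm _).le]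
    simp only [mul_assoc s, average_const_mul]
    ring
  rw [ladMatrix_mulVec (fun x y => by rw [hsymm]) (fun x y => mul_pos hs (h₁ x y))
    (fun x y => mul_pos hs (h₂ x y)) hm, ladMatrix_mulVec hsymm h₁ h₂ hm, hnum, hnum,
    mul_div_mul_left]
  positivity

end Empirical

section Operator

variable {M : Type*} [MeasurableSpace M] {k₁ k₂ : M → M → ℝ} {ν νZ : Measure M} {α : ℝ}

/-- The operator does not change when both kernels are rescaled. -/
theorem adOperator_const_mul {s : ℝ} (hs : 0 < s) (hd : ∀ z, 0 ≤ landmarkDegree k₂ ν νZ z)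
    (f : M → ℝ) (x : M) :
    adOperator (fun x y => s * k₁ x y) (fun x y => s * k₂ x y) ν νZ α f x =
      adOperator k₁ k₂ ν νZ α f x := by
  have hdeg : ∀ z, landmarkDegree (fun x y => s * k₂ x y) ν νZ z =
      s ^ 2 * landmarkDegree k₂ ν νZ z := by
    intro z
    unfold landmarkDegree landmarkKernel
    rw [← integral_const_mul]
    congr 1
    ext z'
    rw [← integral_const_mul]
    congr 1
    ext y
    ring
  have hker : ∀ x y, adKernel (fun x y => s * k₁ x y) (fun x y => s * k₂ x y) ν νZ α x y =
      (s ^ 2 / (s ^ 2) ^ α) * adKernel k₁ k₂ ν νZ α x y := by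
    intro x y
    unfold adKernel
    rw [← integral_const_mul]
    congr 1
    ext z
    rw [hdeg, Real.mul_rpow (by positivity) (hd z)]
    rw [div_mul_div_comm]
    congr 1
    ring
  have hs' : s ^ 2 / (s ^ 2) ^ α ≠ 0 := by positivity
  unfold adOperator adDegree
  simp only [hker, integral_const_mul, mul_div_mul_left _ _ hs']

end Operator

/-! ### Kernels with two-sided integral bounds -/

theorem rpow_neg_mem_Icc_min_max {s α : ℝ} (hs : 0 < s) (hα : α ∈ Set.Icc (0 : ℝ) 1) :
    s ^ (-α) ∈ Set.Icc (min 1 s⁻¹) (max 1 s⁻¹) := by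
  rw [← Real.rpow_neg_one s]
  rcases le_total 1 s with h1 | h1
  · exact ⟨(min_le_right _ _).trans
        (Real.rpow_le_rpow_of_exponent_le h1 (by linarith [hα.2])),
      (Real.rpow_le_one_of_one_le_of_nonpos h1 (by linarith [hα.1])).trans (le_max_left _ _)⟩
  · exact ⟨(min_le_left _ _).trans
        (Real.one_le_rpow_of_pos_of_le_one_of_nonpos hs h1 (by linarith [hα.1])),
      (Real.rpow_le_rpow_of_exponent_ge hs h1 (by linarith [hα.2])).trans (le_max_right _ _)⟩

theorem rpow_neg_mem_Icc {a s α : ℝ} (ha : 1 ≤ a) (hs : s ∈ Set.Icc a⁻¹ a)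
    (hα : α ∈ Set.Icc (0 : ℝ) 1) : s ^ (-α) ∈ Set.Icc a⁻¹ a := by
  have ha0 : 0 < a := by linarith
  have hs0 : 0 < s := (inv_pos.2 ha0).trans_le hs.1
  have h := rpow_neg_mem_Icc_min_max hs0 hα
  exact ⟨(le_min (inv_le_one_of_one_le₀ ha) (inv_anti₀ hs0 hs.2)).trans h.1,
    h.2.trans (max_le ha ((inv_le_comm₀ hs0 ha0).2 hs.1))⟩

theorem abs_rpow_neg_sub_one_le {s τ α : ℝ} (hs : |s - 1| ≤ τ) (hτ : τ ≤ 1 / 2)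
    (hα : α ∈ Set.Icc (0 : ℝ) 1) : |s ^ (-α) - 1| ≤ 2 * τ := by
  obtain ⟨h1, h2⟩ := abs_le.1 hs
  have hs0 : 0 < s := by linarith
  have hτ0 : 0 ≤ τ := (abs_nonneg _).trans hs
  have hinv : s⁻¹ ≤ 1 + 2 * τ := by
    rw [inv_le_iff_one_le_mul₀ hs0]; nlinarith
  have hinv' : 1 - 2 * τ ≤ s⁻¹ := by
    rw [← one_div, le_div_iff₀ hs0]; nlinarith
  have h := rpow_neg_mem_Icc_min_max hs0 hα
  have h3 := (le_min (by linarith) hinv').trans h.1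
  have h4 := h.2.trans (max_le (by linarith) hinv)
  rw [abs_le]
  constructor <;> linarith

section KernelIntegral

variable {M : Type*} [MeasurableSpace M]

/-- The integral operator of a kernel. -/
noncomputable def kernelIntegral (k : M → M → ℝ) (μ : Measure M) (g : M → ℝ) (x : M) : ℝ :=
  ∫ y, k x y * g y ∂μ

/-- A positive measurable kernel bounded by `B` whose integrals over the second variable lie
in `[C⁻¹, C]`. -/
structure IsNormalizedKernel (k : M → M → ℝ) (μ : Measure M) (C B : ℝ) : Prop where
  measurable : Measurable (Function.uncurry k)
  pos : ∀ x y, 0 < k x y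
  le : ∀ x y, k x y ≤ B
  one_le : 1 ≤ C
  le_integral : ∀ x, C⁻¹ ≤ ∫ y, k x y ∂μ
  integral_le : ∀ x, ∫ y, k x y ∂μ ≤ C

namespace IsNormalizedKernel

variable {k : M → M → ℝ} {μ : Measure M} [IsFiniteMeasure μ] {C B : ℝ}

theorem measurable_kernelIntegral (h : IsNormalizedKernel k μ C B) {g : M → ℝ}
    (hg : Measurable g) : Measurable (kernelIntegral k μ g) :=
  ((h.measurable.mul (hg.comp measurable_snd)).stronglyMeasurable.integral_prod_right
    (ν := μ)).measurable

theorem integrable_mul (h : IsNormalizedKernel k μ C B) {g : M → ℝ} (hg : Measurable g) {G : ℝ}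
    (hG : ∀ y, |g y| ≤ G) (x : M) : Integrable (fun y => k x y * g y) μ := by
  refine Integrable.of_bound ((h.measurable.comp measurable_prodMk_left).mul
    hg).aestronglyMeasurable (B * G) (ae_of_all _ fun y => ?_)
  rw [Real.norm_eq_abs, abs_mul, abs_of_pos (h.pos x y)]
  exact mul_le_mul (h.le x y) (hG y) (abs_nonneg _) ((h.pos x y).le.trans (h.le x y))

theorem integrable (h : IsNormalizedKernel k μ C B) (x : M) : Integrable (k x) μ := by
  simpa using h.integrable_mul (g := fun _ => 1) measurable_const (G := 1) (by simp) x

theorem abs_kernelIntegral_le (h : IsNormalizedKernel k μ C B) {g : M → ℝ} {G : ℝ} (hG0 : 0 ≤ G)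
    (hG : ∀ y, |g y| ≤ G) (x : M) : |kernelIntegral k μ g x| ≤ C * G := by
  calc |kernelIntegral k μ g x| ≤ ∫ y, k x y * G ∂μ :=
        norm_integral_le_of_norm_le (f := fun y => k x y * g y) ((h.integrable x).mul_const G)
          (ae_of_all _ fun y => by
            rw [Real.norm_eq_abs, abs_mul, abs_of_pos (h.pos x y)]
            exact mul_le_mul_of_nonneg_left (hG y) (h.pos x y).le)
    _ = (∫ y, k x y ∂μ) * G := integral_mul_const _ _
    _ ≤ C * G := mul_le_mul_of_nonneg_right (h.integral_le x) hG0

theorem le_kernelIntegral (h : IsNormalizedKernel k μ C B) {g : M → ℝ} (hg : Measurable g)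
    {c G : ℝ} (hc0 : 0 ≤ c) (hG : ∀ y, |g y| ≤ G) (hc : ∀ y, c ≤ g y) (x : M) :
    C⁻¹ * c ≤ kernelIntegral k μ g x := by
  calc C⁻¹ * c ≤ (∫ y, k x y ∂μ) * c := mul_le_mul_of_nonneg_right (h.le_integral x) hc0
    _ = ∫ y, k x y * c ∂μ := (integral_mul_const _ _).symm
    _ ≤ _ := integral_mono ((h.integrable x).mul_const c) (h.integrable_mul hg hG x) fun y =>
        mul_le_mul_of_nonneg_left (hc y) (h.pos x y).le

theorem integral_sq_le (h : IsNormalizedKernel k μ C B) {g : M → ℝ} {G : ℝ}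
    (hG : ∀ y, |g y| ≤ G) (x : M) : ∫ y, (k x y * g y) ^ 2 ∂μ ≤ B * C * G ^ 2 := by
  have hB : 0 ≤ B := (h.pos x x).le.trans (h.le x x)
  have hpt : ∀ y, (k x y * g y) ^ 2 ≤ k x y * (B * G ^ 2) := by
    intro y
    have h1 : g y ^ 2 ≤ G ^ 2 := by
      rw [← sq_abs]; exact pow_le_pow_left₀ (abs_nonneg _) (hG y) 2
    calc (k x y * g y) ^ 2 = k x y * (k x y * g y ^ 2) := by ring
      _ ≤ k x y * (B * G ^ 2) := mul_le_mul_of_nonneg_left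
          (mul_le_mul (h.le x y) h1 (sq_nonneg _) hB) (h.pos x y).le
  calc ∫ y, (k x y * g y) ^ 2 ∂μ ≤ ∫ y, k x y * (B * G ^ 2) ∂μ :=
        integral_mono_of_nonneg (ae_of_all _ fun y => sq_nonneg _)
          ((h.integrable x).mul_const _) (ae_of_all _ hpt)
    _ = (∫ y, k x y ∂μ) * (B * G ^ 2) := integral_mul_const _ _
    _ ≤ C * (B * G ^ 2) := mul_le_mul_of_nonneg_right (h.integral_le x) (by positivity)
    _ = _ := by ring

end IsNormalizedKernel

end KernelIntegral

/-! ### The operator in terms of iterated kernel integrals -/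

/-- Two normalized kernels in the configuration of alternating diffusion, the second symmetric. -/
structure IsNormalizedPair {M : Type*} [MeasurableSpace M] (k₁ k₂ : M → M → ℝ) (ν νZ : Measure M)
    (C B : ℝ) : Prop where
  first : IsNormalizedKernel k₁ νZ C B
  second : IsNormalizedKernel k₂ ν C B
  second_landmark : IsNormalizedKernel k₂ νZ C B
  symm : ∀ x y, k₂ x y = k₂ y x

section Pair

variable {M : Type*} [MeasurableSpace M] {k₁ k₂ : M → M → ℝ} {ν νZ : Measure M} {C B α : ℝ}

variable (k₂ ν νZ α) in
/-- The function `d ^ (-α) · ∫ k₂(·, y) f(y) dν(y)`, to which the first kernel is applied. -/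
noncomputable def diffused (f : M → ℝ) (ζ : M) : ℝ :=
  landmarkDegree k₂ ν νZ ζ ^ (-α) * kernelIntegral k₂ ν f ζ

namespace IsNormalizedPair

theorem C_pos (h : IsNormalizedPair k₁ k₂ ν νZ C B) : 0 < C := by linarith [h.first.one_le]

theorem le_kernelIntegral_one [IsFiniteMeasure ν] (h : IsNormalizedPair k₁ k₂ ν νZ C B)
    (ζ : M) : C⁻¹ ≤ kernelIntegral k₂ ν (fun _ => 1) ζ := by
  simpa using h.second.le_kernelIntegral (g := fun _ => 1) (c := 1) (G := 1)
    measurable_const zero_le_one (by simp) (by simp) ζ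

theorem abs_landmarkMass_le [IsFiniteMeasure νZ] (h : IsNormalizedPair k₁ k₂ ν νZ C B)
    (x : M) : |kernelIntegral k₂ νZ (fun _ => 1) x| ≤ C := by
  simpa using h.second_landmark.abs_kernelIntegral_le (g := fun _ => 1) zero_le_one (by simp) x

theorem le_landmarkMass [IsFiniteMeasure νZ] (h : IsNormalizedPair k₁ k₂ ν νZ C B)
    (x : M) : C⁻¹ ≤ kernelIntegral k₂ νZ (fun _ => 1) x := by
  simpa using h.second_landmark.le_kernelIntegral (g := fun _ => 1) (c := 1) (G := 1)
    measurable_const zero_le_one (by simp) (by simp) x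

theorem measurable_landmarkMass [IsFiniteMeasure νZ] (h : IsNormalizedPair k₁ k₂ ν νZ C B) :
    Measurable (kernelIntegral k₂ νZ fun _ => 1) :=
  h.second_landmark.measurable_kernelIntegral measurable_const

variable [IsFiniteMeasure ν] [IsFiniteMeasure νZ]

theorem landmarkDegree_eq (h : IsNormalizedPair k₁ k₂ ν νZ C B) (ζ : M) :
    landmarkDegree k₂ ν νZ ζ = kernelIntegral k₂ ν (kernelIntegral k₂ νZ fun _ => 1) ζ := by
  unfold landmarkDegree landmarkKernel kernelIntegral
  rw [integral_integral_swap]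
  · simp only [mul_one, integral_const_mul]
  · refine Integrable.of_bound (C := B * B) ?_ (ae_of_all _ fun w => ?_)
    · refine Measurable.aestronglyMeasurable (Measurable.mul ?_ ?_)
      · exact h.second.measurable.comp (measurable_const.prodMk measurable_snd)
      · exact h.second.measurable.comp measurable_swap
    · simp only [Function.uncurry, Real.norm_eq_abs, abs_mul, abs_of_pos (h.second.pos _ _)]
      exact mul_le_mul (h.second.le _ _) (h.second.le _ _) (h.second.pos _ _).le
        ((h.second.pos ζ ζ).le.trans (h.second.le ζ ζ))

theorem landmarkDegree_mem (h : IsNormalizedPair k₁ k₂ ν νZ C B) (ζ : M) :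
    landmarkDegree k₂ ν νZ ζ ∈ Set.Icc (C ^ 2)⁻¹ (C ^ 2) := by
  have hC := h.C_pos
  rw [h.landmarkDegree_eq]
  constructor
  · have := h.second.le_kernelIntegral h.measurable_landmarkMass (inv_pos.2 hC).le
      h.abs_landmarkMass_le h.le_landmarkMass ζ
    rwa [← mul_inv, ← sq] at this
  · have := h.second.abs_kernelIntegral_le hC.le h.abs_landmarkMass_le ζ
    rw [← sq] at this
    exact (le_abs_self _).trans this

theorem landmarkDegree_pos (h : IsNormalizedPair k₁ k₂ ν νZ C B) (ζ : M) :
    0 < landmarkDegree k₂ ν νZ ζ :=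
  (inv_pos.2 (pow_pos h.C_pos 2)).trans_le (h.landmarkDegree_mem ζ).1

theorem measurable_landmarkDegree (h : IsNormalizedPair k₁ k₂ ν νZ C B) :
    Measurable (landmarkDegree k₂ ν νZ) := by
  have := h.second.measurable_kernelIntegral h.measurable_landmarkMass
  rwa [← funext h.landmarkDegree_eq] at this

theorem landmarkDegree_rpow_mem (h : IsNormalizedPair k₁ k₂ ν νZ C B)
    (hα : α ∈ Set.Icc (0 : ℝ) 1) (ζ : M) :
    landmarkDegree k₂ ν νZ ζ ^ (-α) ∈ Set.Icc (C ^ 2)⁻¹ (C ^ 2) :=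
  rpow_neg_mem_Icc (one_le_pow₀ h.first.one_le) (h.landmarkDegree_mem ζ) hα

theorem measurable_diffused (h : IsNormalizedPair k₁ k₂ ν νZ C B) {f : M → ℝ} (hf : Measurable f) :
    Measurable (diffused k₂ ν νZ α f) :=
  (h.measurable_landmarkDegree.pow_const _).mul (h.second.measurable_kernelIntegral hf)

theorem abs_diffused_le (h : IsNormalizedPair k₁ k₂ ν νZ C B)
    (hα : α ∈ Set.Icc (0 : ℝ) 1) {f : M → ℝ} (hf : ∀ y, |f y| ≤ C) (ζ : M) :
    |diffused k₂ ν νZ α f ζ| ≤ C ^ 4 := by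
  have hC := h.C_pos
  have h1 := h.landmarkDegree_rpow_mem hα ζ
  have h2 := h.second.abs_kernelIntegral_le hC.le hf ζ
  unfold diffused
  rw [abs_mul, abs_of_pos ((inv_pos.2 (pow_pos hC 2)).trans_le h1.1)]
  calc _ ≤ C ^ 2 * (C * C) := mul_le_mul h1.2 h2 (abs_nonneg _) (by positivity)
    _ = C ^ 4 := by ring

theorem le_diffused_one (h : IsNormalizedPair k₁ k₂ ν νZ C B)
    (hα : α ∈ Set.Icc (0 : ℝ) 1) (ζ : M) :
    (C ^ 3)⁻¹ ≤ diffused k₂ ν νZ α (fun _ => 1) ζ := by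
  have hC := h.C_pos
  calc (C ^ 3)⁻¹ = (C ^ 2)⁻¹ * C⁻¹ := by rw [← mul_inv]; ring
    _ ≤ _ := mul_le_mul (h.landmarkDegree_rpow_mem hα ζ).1 (h.le_kernelIntegral_one ζ)
        (inv_pos.2 hC).le ((inv_pos.2 (by positivity)).le.trans
          (h.landmarkDegree_rpow_mem hα ζ).1)

/-- By Fubini, integrating the kernel against `f` applies the
second kernel, the weight `d ^ (-α)` and the first kernel in turn. -/
theorem integral_adKernel_mul (h : IsNormalizedPair k₁ k₂ ν νZ C B)
    (hα : α ∈ Set.Icc (0 : ℝ) 1) {f : M → ℝ} (hf : Measurable f)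
    (hfC : ∀ y, |f y| ≤ C) (x : M) :
    ∫ y, adKernel k₁ k₂ ν νZ α x y * f y ∂ν =
      kernelIntegral k₁ νZ (diffused k₂ ν νZ α f) x := by
  have hB : 0 ≤ B := (h.first.pos x x).le.trans (h.first.le x x)
  have hC := h.C_pos
  have hpt : ∀ y z, k₁ x z * k₂ z y / landmarkDegree k₂ ν νZ z ^ α * f y =
      k₁ x z * (landmarkDegree k₂ ν νZ z ^ (-α) * (k₂ z y * f y)) := by
    intro y z
    rw [Real.rpow_neg (h.landmarkDegree_pos z).le]
    ring
  unfold adKernel kernelIntegral diffused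
  simp only [← integral_mul_const, hpt]
  rw [integral_integral_swap]
  · simp only [integral_const_mul]; rfl
  · refine Integrable.of_bound (C := B * (C ^ 2 * (B * C))) ?_ (ae_of_all _ fun w => ?_)
    · refine Measurable.aestronglyMeasurable (Measurable.mul ?_ (Measurable.mul ?_
        (Measurable.mul ?_ ?_)))
      · exact h.first.measurable.comp (measurable_const.prodMk measurable_snd)
      · exact (h.measurable_landmarkDegree.pow_const _).comp measurable_snd
      · exact h.second.measurable.comp measurable_swap
      · exact hf.comp measurable_fst
    · have h1 := h.landmarkDegree_rpow_mem hα w.2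
      have h2 : 0 < landmarkDegree k₂ ν νZ w.2 ^ (-α) := Real.rpow_pos_of_pos
        (h.landmarkDegree_pos _) _
      simp only [Function.uncurry, Real.norm_eq_abs, abs_mul, abs_of_pos (h.second.pos _ _),
        abs_of_pos (h.first.pos _ _), abs_of_pos h2]
      have := h.first.le x w.2
      have := h.second.le w.2 w.1
      have := (h.second.pos w.2 w.1).le
      have := hfC w.1
      have := h1.2
      gcongr

theorem adOperator_eq (h : IsNormalizedPair k₁ k₂ ν νZ C B)
    (hα : α ∈ Set.Icc (0 : ℝ) 1) {f : M → ℝ} (hf : Measurable f)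
    (hfC : ∀ y, |f y| ≤ C) (x : M) :
    adOperator k₁ k₂ ν νZ α f x = kernelIntegral k₁ νZ (diffused k₂ ν νZ α f) x /
      kernelIntegral k₁ νZ (diffused k₂ ν νZ α fun _ => 1) x := by
  rw [← h.integral_adKernel_mul hα hf hfC, ← h.integral_adKernel_mul hα (f := fun _ => 1)
    measurable_const (fun _ => by simpa using h.first.one_le)]
  unfold adOperator adDegree
  simp only [mul_one]
  rw [← integral_div]
  congr 1
  ext y
  ring

end IsNormalizedPair

end Pair

/-! ### From deviations of averages to the deviation of the matrix -/

theorem abs_div_sub_div_le {a a' b b' e δ K : ℝ} (ha : |a' - a| ≤ e) (hb : |b' - b| ≤ e)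
    (hδ : 0 < δ) (hbδ : δ ≤ b) (he : e ≤ δ / 2) (hK : |a| ≤ K) :
    |a' / b' - a / b| ≤ 2 * e / δ * (1 + K / δ) := by
  have he0 : 0 ≤ e := (abs_nonneg _).trans ha
  have hK0 : 0 ≤ K := (abs_nonneg _).trans hK
  have hb0 : 0 < b := hδ.trans_le hbδ
  have hb' : δ / 2 ≤ b' := by have := (abs_le.1 hb).1; linarith
  have hb'0 : 0 < b' := (half_pos hδ).trans_le hb'
  have hab : |a / b| ≤ K / δ := by
    rw [abs_div, abs_of_pos hb0]
    exact div_le_div₀ hK0 hK hδ hbδ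
  have heq : a' / b' - a / b = ((a' - a) - a / b * (b' - b)) / b' := by
    field_simp
    ring
  rw [heq, abs_div, abs_of_pos hb'0]
  calc |a' - a - a / b * (b' - b)| / b' ≤ (e * (1 + K / δ)) / (δ / 2) := by
        refine div_le_div₀ (by positivity) ?_ (by positivity) hb'
        calc |a' - a - a / b * (b' - b)| ≤ |a' - a| + |a / b * (b' - b)| := abs_sub _ _
          _ ≤ e + K / δ * e := by
              rw [abs_mul]
              gcongr
          _ = e * (1 + K / δ) := by ring
    _ = 2 * e / δ * (1 + K / δ) := by field_simp

section Deterministic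

variable {M : Type*} [MeasurableSpace M]

/-- The error made in replacing `∫ k(ξ, y) g(y) dμ(y)` by the average over `y`. -/
noncomputable def deviation {N : ℕ} (k : M → M → ℝ) (μ : Measure M) (g : M → ℝ) (y : Fin N → M)
    (ξ : M) : ℝ :=
  |average (fun t => k ξ t * g t) y - kernelIntegral k μ g ξ|

namespace IsNormalizedPair

variable {k₁ k₂ : M → M → ℝ} {ν νZ : Measure M} {C B α : ℝ} [IsFiniteMeasure ν]
  [IsFiniteMeasure νZ] {n m : ℕ} {x : Fin n → M} {z : Fin m → M} {η : ℝ}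

/-- The empirical degree is a double sum over both samples. It is handled in two steps,
each an average over one sample at points of the other: the inner average over the landmarks is
replaced by its integral at all `x j`, then the outer average at `ζ`. -/
theorem abs_empiricalDegree_sub_le (h : IsNormalizedPair k₁ k₂ ν νZ C B) (hη : 0 ≤ η)
    (hη1 : η ≤ 1) {ζ : M} (e₁ : ∀ j, deviation k₂ νZ (fun _ => 1) z (x j) ≤ η)
    (e₂ : deviation k₂ ν (fun _ => 1) x ζ ≤ η)
    (e₃ : deviation k₂ ν (kernelIntegral k₂ νZ fun _ => 1) x ζ ≤ η) :
    |empiricalDegree k₂ x z ζ - landmarkDegree k₂ ν νZ ζ| ≤ 3 * C * η := by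
  have hC := h.first.one_le
  unfold deviation at e₁ e₂ e₃
  have h1 : |empiricalDegree k₂ x z ζ -
      average (fun y => k₂ ζ y * kernelIntegral k₂ νZ (fun _ => 1) y) x| ≤
        η * average (fun y => k₂ ζ y * 1) x := by
    refine abs_average_sub_le fun j => ?_
    rw [← mul_sub, abs_mul, abs_of_pos (h.second.pos _ _), mul_one, mul_comm η]
    have := e₁ j
    simp only [mul_one] at this
    exact mul_le_mul_of_nonneg_left this (h.second.pos _ _).le
  have h2 : average (fun y => k₂ ζ y * 1) x ≤ 2 * C := by
    have h3 := (abs_le.1 e₂).2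
    have h4 := (le_abs_self _).trans
      (h.second.abs_kernelIntegral_le (g := fun _ => 1) zero_le_one (by simp) ζ)
    linarith
  rw [h.landmarkDegree_eq]
  have h5 := abs_sub_le (empiricalDegree k₂ x z ζ)
    (average (fun y => k₂ ζ y * kernelIntegral k₂ νZ (fun _ => 1) y) x)
    (kernelIntegral k₂ ν (kernelIntegral k₂ νZ fun _ => 1) ζ)
  have h6 : η * average (fun y => k₂ ζ y * 1) x ≤ η * (2 * C) := by gcongr
  nlinarith

/-- The error relative to `diffused 1`, a positive function, so that it can be averaged against the
first kernel. -/
theorem abs_empirical_diffused_sub_le (h : IsNormalizedPair k₁ k₂ ν νZ C B)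
    (hα : α ∈ Set.Icc (0 : ℝ) 1) (hη : 0 ≤ η) (hη1 : 6 * C ^ 3 * η ≤ 1) {f : M → ℝ}
    (hfC : ∀ y, |f y| ≤ C) {ζ : M} (e₁ : ∀ j, deviation k₂ νZ (fun _ => 1) z (x j) ≤ η)
    (e₂ : deviation k₂ ν (fun _ => 1) x ζ ≤ η)
    (e₃ : deviation k₂ ν (kernelIntegral k₂ νZ fun _ => 1) x ζ ≤ η)
    (e₄ : deviation k₂ ν f x ζ ≤ η) :
    |empiricalDegree k₂ x z ζ ^ (-α) * average (fun y => k₂ ζ y * f y) x -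
        diffused k₂ ν νZ α f ζ| ≤
      8 * C ^ 6 * η * diffused k₂ ν νZ α (fun _ => 1) ζ := by
  have hC := h.first.one_le
  have hC0 := h.C_pos
  have hC3 : 1 ≤ C ^ 3 := one_le_pow₀ hC
  have hη2 : η ≤ 1 := by nlinarith
  have hd := h.landmarkDegree_pos ζ
  have hdeg := h.abs_empiricalDegree_sub_le hη hη2 e₁ e₂ e₃
  set δ := landmarkDegree k₂ ν νZ ζ with hδ
  set s := empiricalDegree k₂ x z ζ / δ with hs
  have hδinv : δ⁻¹ ≤ C ^ 2 := by
    rw [inv_le_comm₀ hd (by positivity)]; exact (h.landmarkDegree_mem ζ).1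
  -- the relative error of the degree
  have hs1 : |s - 1| ≤ 3 * C ^ 3 * η := by
    have : s - 1 = (empiricalDegree k₂ x z ζ - δ) * δ⁻¹ := by rw [hs]; field_simp
    rw [this, abs_mul, abs_of_pos (inv_pos.2 hd)]
    calc _ ≤ (3 * C * η) * C ^ 2 := by gcongr
      _ = _ := by ring
  have hsα := abs_rpow_neg_sub_one_le hs1 (by linarith) hα
  have hs0 : 0 < s := by have := (abs_le.1 hs1).1; nlinarith
  have hfac : empiricalDegree k₂ x z ζ ^ (-α) = δ ^ (-α) * s ^ (-α) := by
    rw [← Real.mul_rpow hd.le hs0.le, hs, mul_div_cancel₀ _ hd.ne']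
  have hδα : 0 < δ ^ (-α) := Real.rpow_pos_of_pos hd _
  have hU := h.second.abs_kernelIntegral_le hC0.le hfC ζ
  set U := kernelIntegral k₂ ν f ζ with hUdef
  set u := average (fun y => k₂ ζ y * f y) x with hu
  have hdev : |u - U| ≤ η := e₄
  have hs2 : s ^ (-α) ≤ 2 := by have := (abs_le.1 hsα).2; linarith
  have hcore : |s ^ (-α) * u - U| ≤ 8 * C ^ 5 * η := by
    have heq : s ^ (-α) * u - U = s ^ (-α) * (u - U) + (s ^ (-α) - 1) * U := by ring
    have hC5 : 1 ≤ C ^ 5 := one_le_pow₀ hC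
    rw [heq]
    calc _ ≤ |s ^ (-α) * (u - U)| + |(s ^ (-α) - 1) * U| := abs_add_le _ _
      _ ≤ 2 * η + (2 * (3 * C ^ 3 * η)) * (C * C) := by
          rw [abs_mul, abs_mul, abs_of_pos (Real.rpow_pos_of_pos hs0 _)]
          gcongr
      _ ≤ 2 * (C ^ 5 * η) + 6 * C ^ 5 * η := by nlinarith
      _ = _ := by ring
  have hone : 1 ≤ C * kernelIntegral k₂ ν (fun _ => 1) ζ := by
    have := h.le_kernelIntegral_one ζ
    rwa [inv_le_iff_one_le_mul₀' hC0] at this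
  unfold diffused
  rw [hfac, ← hδ, mul_assoc, ← mul_sub, abs_mul, abs_of_pos hδα]
  calc δ ^ (-α) * |s ^ (-α) * u - U| ≤ δ ^ (-α) * (8 * C ^ 5 * η) := by gcongr
    _ = δ ^ (-α) * (8 * C ^ 5 * η) * 1 := (mul_one _).symm
    _ ≤ δ ^ (-α) * (8 * C ^ 5 * η) * (C * kernelIntegral k₂ ν (fun _ => 1) ζ) := by gcongr
    _ = _ := by ring

theorem abs_empiricalNumerator_sub_le (h : IsNormalizedPair k₁ k₂ ν νZ C B)
    (hα : α ∈ Set.Icc (0 : ℝ) 1) (hη : 0 ≤ η) (hη1 : 6 * C ^ 3 * η ≤ 1) {f : M → ℝ}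
    (hfC : ∀ y, |f y| ≤ C) {ξ : M} (e₁ : ∀ j, deviation k₂ νZ (fun _ => 1) z (x j) ≤ η)
    (e₂ : ∀ k, deviation k₂ ν (fun _ => 1) x (z k) ≤ η)
    (e₃ : ∀ k, deviation k₂ ν (kernelIntegral k₂ νZ fun _ => 1) x (z k) ≤ η)
    (e₄ : ∀ k, deviation k₂ ν f x (z k) ≤ η)
    (e₅ : deviation k₁ νZ (diffused k₂ ν νZ α fun _ => 1) z ξ ≤ η)
    (e₆ : deviation k₁ νZ (diffused k₂ ν νZ α f) z ξ ≤ η) :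
    |empiricalNumerator k₁ k₂ α x z f ξ - kernelIntegral k₁ νZ (diffused k₂ ν νZ α f) ξ| ≤
      17 * C ^ 11 * η := by
  have hC := h.first.one_le
  have hC0 := h.C_pos
  have hC5 : 1 ≤ C ^ 5 := one_le_pow₀ hC
  have hC11 : 1 ≤ C ^ 11 := one_le_pow₀ hC
  have hη2 : η ≤ 1 := by have : 1 ≤ C ^ 3 := one_le_pow₀ hC; nlinarith
  have h1 : |empiricalNumerator k₁ k₂ α x z f ξ -
      average (fun ζ => k₁ ξ ζ * diffused k₂ ν νZ α f ζ) z| ≤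
        8 * C ^ 6 * η * average (fun ζ => k₁ ξ ζ * diffused k₂ ν νZ α (fun _ => 1) ζ) z := by
    refine abs_average_sub_le fun k => ?_
    rw [← mul_sub, abs_mul, abs_of_pos (h.first.pos _ _), mul_left_comm]
    exact mul_le_mul_of_nonneg_left
      (h.abs_empirical_diffused_sub_le hα hη hη1 hfC e₁ (e₂ k) (e₃ k) (e₄ k)) (h.first.pos _ _).le
  have h2 : average (fun ζ => k₁ ξ ζ * diffused k₂ ν νZ α (fun _ => 1) ζ) z ≤ 2 * C ^ 5 := by
    have h3 := (abs_le.1 e₅).2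
    have h4 := (le_abs_self _).trans (h.first.abs_kernelIntegral_le (by positivity)
      (h.abs_diffused_le hα (f := fun _ => 1) (fun _ => by simpa using hC)) ξ)
    have h5 : C * C ^ 4 = C ^ 5 := by ring
    linarith
  calc _ ≤ |empiricalNumerator k₁ k₂ α x z f ξ -
        average (fun ζ => k₁ ξ ζ * diffused k₂ ν νZ α f ζ) z| +
        |average (fun ζ => k₁ ξ ζ * diffused k₂ ν νZ α f ζ) z -
          kernelIntegral k₁ νZ (diffused k₂ ν νZ α f) ξ| := abs_sub_le _ _ _
    _ ≤ 8 * C ^ 6 * η * (2 * C ^ 5) + η := add_le_add (h1.trans (by gcongr)) e₆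
    _ ≤ _ := by nlinarith

/-- If the empirical averages entering the matrix are `η`-close to their integrals, then the matrix
is `O(η)`-close to the operator. -/
theorem abs_ladMatrix_sub_adOperator_le (h : IsNormalizedPair k₁ k₂ ν νZ C B)
    (hα : α ∈ Set.Icc (0 : ℝ) 1) (hη : 0 ≤ η) (hη1 : 34 * C ^ 15 * η ≤ 1) {f : M → ℝ}
    (hf : Measurable f) (hfC : ∀ y, |f y| ≤ C) (hm : 0 < m)
    (e₁ : ∀ j, deviation k₂ νZ (fun _ => 1) z (x j) ≤ η)
    (e₂ : ∀ k, deviation k₂ ν (fun _ => 1) x (z k) ≤ η)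
    (e₃ : ∀ k, deviation k₂ ν (kernelIntegral k₂ νZ fun _ => 1) x (z k) ≤ η)
    (e₄ : ∀ k, deviation k₂ ν f x (z k) ≤ η)
    (e₅ : ∀ i, deviation k₁ νZ (diffused k₂ ν νZ α fun _ => 1) z (x i) ≤ η)
    (e₆ : ∀ i, deviation k₁ νZ (diffused k₂ ν νZ α f) z (x i) ≤ η) (i : Fin n) :
    |(ladMatrix k₁ k₂ α x z *ᵥ fun j => f (x j)) i - adOperator k₁ k₂ ν νZ α f (x i)| ≤
      68 * C ^ 24 * η := by
  have hC := h.first.one_le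
  have hC0 := h.C_pos
  have hη2 : 6 * C ^ 3 * η ≤ 1 := by
    have : C ^ 3 ≤ C ^ 15 := pow_le_pow_right₀ hC (by norm_num)
    have : C ^ 3 * η ≤ C ^ 15 * η := by gcongr
    have : 0 ≤ C ^ 15 * η := by positivity
    nlinarith
  rw [ladMatrix_mulVec h.symm h.first.pos h.second.pos hm, h.adOperator_eq hα hf hfC]
  have hone : ∀ y : M, |(fun _ => (1 : ℝ)) y| ≤ C := fun _ => by simpa using hC
  have hnum := h.abs_empiricalNumerator_sub_le hα hη hη2 hfC e₁ e₂ e₃ e₄ (e₅ i) (e₆ i)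
  have hden := h.abs_empiricalNumerator_sub_le hα hη hη2 hone e₁ e₂ e₃ e₂ (e₅ i) (e₅ i)
  have hlow : (C ^ 4)⁻¹ ≤ kernelIntegral k₁ νZ (diffused k₂ ν νZ α fun _ => 1) (x i) := by
    have := h.first.le_kernelIntegral (h.measurable_diffused (α := α) measurable_const)
      (by positivity) (h.abs_diffused_le hα hone) (h.le_diffused_one hα) (x i)
    calc (C ^ 4)⁻¹ = C⁻¹ * (C ^ 3)⁻¹ := by rw [← mul_inv]; ring
      _ ≤ _ := this
  have hupp := h.first.abs_kernelIntegral_le (by positivity) (h.abs_diffused_le hα hfC) (x i)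
  have hsmall : 17 * C ^ 11 * η ≤ (C ^ 4)⁻¹ / 2 := by
    rw [le_div_iff₀ two_pos, ← one_div, le_div_iff₀ (by positivity)]
    calc _ = 34 * C ^ 15 * η := by ring
      _ ≤ 1 := hη1
  refine (abs_div_sub_div_le hnum hden (by positivity) hlow hsmall hupp).trans ?_
  have hC9 : 1 ≤ C ^ 9 := one_le_pow₀ hC
  rw [div_inv_eq_mul, div_inv_eq_mul]
  calc 2 * (17 * C ^ 11 * η) * C ^ 4 * (1 + C * C ^ 4 * C ^ 4)
      = 34 * C ^ 15 * η * (1 + C ^ 9) := by ring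
    _ ≤ 34 * C ^ 15 * η * (C ^ 9 + C ^ 9) := by gcongr
    _ = _ := by ring

end IsNormalizedPair

end Deterministic

/-! ### The probabilistic estimate for normalized kernels -/

section Probabilistic

variable {M Ω : Type*} [MeasurableSpace M] [MeasurableSpace Ω] {P : Measure Ω}
  [IsProbabilityMeasure P] {X Z : ℕ → Ω → M} {C B η : ℝ}

/-- The variance of `k(x, ·) g` is `O(B)`, not `O(B²)`, because `k(x, ·)` has integral `O(1)`; this
gives the exponent `N η² / B`. -/
theorem IsNormalizedKernel.measureReal_exists_deviation_le {k : M → M → ℝ} {μ : Measure M}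
    [IsFiniteMeasure μ] [Nonempty M] (h : IsNormalizedKernel k μ C B)
    (hind : iIndepFun (Sum.elim X Z : ℕ ⊕ ℕ → Ω → M) P)
    (hX : ∀ i, Measurable (X i)) (hZ : ∀ k, Measurable (Z k)) (hlaw : ∀ k, P.map (Z k) = μ)
    {g : M → ℝ} (hg : Measurable g) (hgC : ∀ y, |g y| ≤ C ^ 4) (hη : 0 ≤ η) (hη1 : η ≤ 1)
    (n N : ℕ) :
    P.real {w | ∃ i : Fin n, η < deviation k μ g (fun l : Fin N => Z l w) (X i w)} ≤
      n * (2 * Real.exp (-(N * η ^ 2 / (4 * (B * C ^ 9))))) := by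
  obtain ⟨x₀⟩ := ‹Nonempty M›
  have hB : 0 < B := (h.pos x₀ x₀).trans_le (h.le x₀ x₀)
  have hC := h.one_le
  have hC0 : 0 < C := by linarith
  have hC5 : 1 ≤ C ^ 5 := one_le_pow₀ hC
  refine LAD.measureReal_exists_deviation_le (h := fun x y => k x y * g y) (B := B * C ^ 4) hind hX
    hZ hlaw
    (h.measurable.mul (hg.comp measurable_snd)) (fun x y => ?_) (fun x => ?_) (by positivity) hη
    ?_ n N
  · rw [abs_mul, abs_of_pos (h.pos x y)]
    exact mul_le_mul (h.le x y) (hgC y) (abs_nonneg _) hB.le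
  · refine (h.integral_sq_le hgC x).trans (le_of_eq ?_)
    ring
  · calc η * (B * C ^ 4) ≤ C ^ 5 * (B * C ^ 4) := by gcongr; linarith
      _ = B * C ^ 9 := by ring

/-- A union bound over the six families of averages in
`IsNormalizedPair.abs_ladMatrix_sub_adOperator_le`. -/
theorem IsNormalizedPair.measureReal_not_forall_le {k₁ k₂ : M → M → ℝ} {ν νZ : Measure M} {α : ℝ}
    [IsFiniteMeasure ν] [IsFiniteMeasure νZ] [Nonempty M]
    (h : IsNormalizedPair k₁ k₂ ν νZ C B) (hind : iIndepFun (Sum.elim X Z : ℕ ⊕ ℕ → Ω → M) P)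
    (hX : ∀ i, Measurable (X i)) (hZ : ∀ k, Measurable (Z k)) (hXlaw : ∀ i, P.map (X i) = ν)
    (hZlaw : ∀ k, P.map (Z k) = νZ) (hα : α ∈ Set.Icc (0 : ℝ) 1) {f : M → ℝ} (hf : Measurable f)
    (hfC : ∀ y, |f y| ≤ C) (hη : 0 ≤ η) (hη1 : 34 * C ^ 15 * η ≤ 1) {n m : ℕ} (hm : 0 < m)
    (hmn : m ≤ n) :
    P.real {w | ¬ ∀ i : Fin n,
        |(ladMatrix k₁ k₂ α (fun j : Fin n => X j w) (fun k : Fin m => Z k w) *ᵥ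
          fun j => f (X j w)) i - adOperator k₁ k₂ ν νZ α f (X i w)| ≤ 68 * C ^ 24 * η} ≤
      12 * (n * Real.exp (-(m * η ^ 2 / (4 * (B * C ^ 9))))) := by
  have hC := h.first.one_le
  have hC0 := h.C_pos
  obtain ⟨x₀⟩ := id ‹Nonempty M›
  have hB : 0 < B := (h.first.pos x₀ x₀).trans_le (h.first.le x₀ x₀)
  have hη2 : η ≤ 1 := by
    have : 1 ≤ C ^ 15 := one_le_pow₀ hC
    nlinarith
  have hswap := iIndepFun_sumElim_swap hind
  have hC4 : C ≤ C ^ 4 := le_self_pow₀ hC (by norm_num)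
  have hone : ∀ y : M, |(fun _ => (1 : ℝ)) y| ≤ C := fun _ => by simpa using hC
  set b := n * (2 * Real.exp (-(m * η ^ 2 / (4 * (B * C ^ 9))))) with hb
  have hle : m * (2 * Real.exp (-(n * η ^ 2 / (4 * (B * C ^ 9))))) ≤ b := by
    have hmn' : (m : ℝ) ≤ n := by exact_mod_cast hmn
    rw [hb]
    gcongr
  have b₁ := h.second_landmark.measureReal_exists_deviation_le hind hX hZ hZlaw
    (g := fun _ => 1) measurable_const (fun y => (hone y).trans hC4) hη hη2 n m
  have b₂ := (h.second.measureReal_exists_deviation_le hswap hZ hX hXlaw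
    (g := fun _ => 1) measurable_const (fun y => (hone y).trans hC4) hη hη2 m n).trans hle
  have b₃ := (h.second.measureReal_exists_deviation_le hswap hZ hX hXlaw
    h.measurable_landmarkMass (fun y => (h.abs_landmarkMass_le y).trans hC4) hη hη2 m n).trans hle
  have b₄ := (h.second.measureReal_exists_deviation_le hswap hZ hX hXlaw
    hf (fun y => (hfC y).trans hC4) hη hη2 m n).trans hle
  have b₅ := h.first.measureReal_exists_deviation_le hind hX hZ hZlaw
    (h.measurable_diffused (α := α) (f := fun _ => 1) measurable_const)
    (h.abs_diffused_le hα hone) hη hη2 n m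
  have b₆ := h.first.measureReal_exists_deviation_le hind hX hZ hZlaw
    (h.measurable_diffused (α := α) hf) (h.abs_diffused_le hα hfC) hη hη2 n m
  set E₁ := {w | ∃ i : Fin n, η < deviation k₂ νZ (fun _ => 1) (fun l : Fin m => Z l w) (X i w)}
  set E₂ := {w | ∃ i : Fin m, η < deviation k₂ ν (fun _ => 1) (fun l : Fin n => X l w) (Z i w)}
  set E₃ := {w | ∃ i : Fin m, η < deviation k₂ ν (kernelIntegral k₂ νZ fun _ => 1)
    (fun l : Fin n => X l w) (Z i w)}
  set E₄ := {w | ∃ i : Fin m, η < deviation k₂ ν f (fun l : Fin n => X l w) (Z i w)}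
  set E₅ := {w | ∃ i : Fin n, η < deviation k₁ νZ (diffused k₂ ν νZ α fun _ => 1)
    (fun l : Fin m => Z l w) (X i w)}
  set E₆ := {w | ∃ i : Fin n, η < deviation k₁ νZ (diffused k₂ ν νZ α f)
    (fun l : Fin m => Z l w) (X i w)}
  have hsub : {w | ¬ ∀ i : Fin n,
      |(ladMatrix k₁ k₂ α (fun j : Fin n => X j w) (fun k : Fin m => Z k w) *ᵥ
        fun j => f (X j w)) i - adOperator k₁ k₂ ν νZ α f (X i w)| ≤ 68 * C ^ 24 * η} ⊆
      E₁ ∪ (E₂ ∪ (E₃ ∪ (E₄ ∪ (E₅ ∪ E₆)))) := by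
    intro w hw
    by_contra hE
    simp only [Set.mem_union, not_or] at hE
    obtain ⟨h₁, h₂, h₃, h₄, h₅, h₆⟩ := hE
    refine hw (h.abs_ladMatrix_sub_adOperator_le hα hη hη1 hf hfC hm
      (fun j => not_lt.1 fun hj => h₁ ⟨j, hj⟩) (fun j => not_lt.1 fun hj => h₂ ⟨j, hj⟩)
      (fun j => not_lt.1 fun hj => h₃ ⟨j, hj⟩) (fun j => not_lt.1 fun hj => h₄ ⟨j, hj⟩)
      (fun j => not_lt.1 fun hj => h₅ ⟨j, hj⟩) (fun j => not_lt.1 fun hj => h₆ ⟨j, hj⟩))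
  have u₁ := measureReal_union_le (μ := P) E₁ (E₂ ∪ (E₃ ∪ (E₄ ∪ (E₅ ∪ E₆))))
  have u₂ := measureReal_union_le (μ := P) E₂ (E₃ ∪ (E₄ ∪ (E₅ ∪ E₆)))
  have u₃ := measureReal_union_le (μ := P) E₃ (E₄ ∪ (E₅ ∪ E₆))
  have u₄ := measureReal_union_le (μ := P) E₄ (E₅ ∪ E₆)
  have u₅ := measureReal_union_le (μ := P) E₅ E₆
  have hmono := measureReal_mono (μ := P) hsub
  linarith

end Probabilistic

/-! ### Integrals of the kernels at small bandwidth -/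

section Profile

variable {d : ℕ} {K : ℝ → ℝ}

theorem IsKernelProfile.exists_le_exp (hK : IsKernelProfile d K) {q : ℕ} (hq : q = 1 ∨ q = 2) :
    ∃ A > 0, ∃ a > 0, ∀ t, 0 ≤ t → K (t ^ q) ≤ A * Real.exp (-a * t) := by
  obtain ⟨c₁, hc₁, c₂, hc₂, h⟩ := hK.decay
  refine ⟨c₁ * Real.exp c₂, by positivity, c₂, hc₂, fun t ht => ?_⟩
  have h1 := (h (t ^ q) (by positivity)).1.le
  -- crude, but exponential decay is all that is needed
  have h2 : t - 1 ≤ (t ^ q) ^ 2 := by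
    rcases hq with rfl | rfl <;> nlinarith [sq_nonneg (t - 1), sq_nonneg (t ^ 2 - 1), sq_nonneg t]
  refine h1.trans ?_
  rw [mul_assoc, ← Real.exp_add]
  gcongr
  nlinarith

theorem IsKernelProfile.exists_le_on_unit (hK : IsKernelProfile d K) :
    ∃ c > 0, ∀ t, 0 ≤ t → t ≤ 1 → c ≤ K t := by
  obtain ⟨t₀, ht₀, hmin⟩ := isCompact_Icc.exists_isMinOn (Set.nonempty_Icc.2 zero_le_one)
    (hK.contDiffOn.continuousOn.mono (Set.Icc_subset_Ici_self (a := (1 : ℝ)) (b := 0)))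
  exact ⟨K t₀, hK.pos t₀ ht₀.1, fun t h0 h1 => hmin ⟨h0, h1⟩⟩

end Profile

section KernelBounds

variable {M : Type*} {p d q : ℕ} {K : ℝ → ℝ} {κ : M → EuclideanSpace ℝ (Fin p)} {ε : ℝ}

theorem kernel_symm (x y : M) : kernel q K κ ε x y = kernel q K κ ε y x := by
  unfold kernel; rw [norm_sub_rev]

theorem kernel_pos (hK : IsKernelProfile d K) (x y : M) : 0 < kernel q K κ ε x y :=
  hK.pos _ (by positivity)

theorem kernel_le {A a : ℝ} (hA : 0 < A) (ha : 0 < a)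
    (hdecay : ∀ t, 0 ≤ t → K (t ^ q) ≤ A * Real.exp (-a * t)) (x y : M) :
    kernel q K κ ε x y ≤ A := by
  have h0 : 0 ≤ ‖κ x - κ y‖ / Real.sqrt ε := by positivity
  refine (hdecay _ h0).trans (mul_le_of_le_one_right hA.le (Real.exp_le_one_iff.2 ?_))
  nlinarith

variable [TopologicalSpace M]

theorem continuous_kernel (hK : IsKernelProfile d K) (hκ : Continuous κ) :
    Continuous (Function.uncurry (kernel q K κ ε)) := by
  unfold kernel Function.uncurry
  refine hK.contDiffOn.continuousOn.comp_continuous ?_ fun w => ?_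
  · exact (((hκ.comp continuous_fst).sub (hκ.comp continuous_snd)).norm.div_const _).pow q
  · show 0 ≤ (‖κ w.1 - κ w.2‖ / Real.sqrt ε) ^ q
    positivity

variable [MeasurableSpace M] [BorelSpace M] {μ : Measure M}

/-- An exponentially decaying profile is dominated by a sum of indicators of balls, so balls of
volume `O(r ^ d)` give integrals `O(ε ^ (d / 2))`. -/
theorem lintegral_kernel_le (hκ : Continuous κ) {C A a : ℝ} (hC : 0 < C) (hA : 0 < A)
    (ha : 0 < a) (hball : ∀ x r, 0 < r → μ (extrinsicBall κ x r) ≤ ENNReal.ofReal (C * r ^ d))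
    (hdecay : ∀ t, 0 ≤ t → K (t ^ q) ≤ A * Real.exp (-a * t)) (hε : 0 < ε) (x : M) :
    ∫⁻ y, ENNReal.ofReal (kernel q K κ ε x y) ∂μ ≤
      ENNReal.ofReal ((A * C * ∑' k : ℕ, ((k : ℝ) + 1) ^ d * Real.exp (-a * k)) *
        Real.sqrt ε ^ d) := by
  have hsq : 0 < Real.sqrt ε := Real.sqrt_pos.2 hε
  have hsummable : Summable fun k : ℕ => ((k : ℝ) + 1) ^ d * Real.exp (-a * k) := by
    have h1 := (summable_nat_add_iff 1).2 (Real.summable_pow_mul_exp_neg_nat_mul d ha)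
    refine (h1.mul_left (Real.exp a)).congr fun k => ?_
    rw [mul_left_comm, ← Real.exp_add]
    push_cast
    congr 2
    ring
  have hpt : ∀ y, ENNReal.ofReal (kernel q K κ ε x y) ≤
      ∑' k : ℕ, (extrinsicBall κ x ((k + 1) * Real.sqrt ε)).indicator
        (fun _ => ENNReal.ofReal (A * Real.exp (-a * k))) y := by
    intro y
    set t := ‖κ x - κ y‖ / Real.sqrt ε with ht
    have ht0 : 0 ≤ t := by positivity
    have hmem : y ∈ extrinsicBall κ x (((⌊t⌋₊ : ℝ) + 1) * Real.sqrt ε) := by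
      have := (Nat.lt_floor_add_one t).le
      rwa [ht, div_le_iff₀ hsq] at this
    refine le_trans ?_ (ENNReal.le_tsum ⌊t⌋₊)
    rw [Set.indicator_of_mem hmem]
    refine ENNReal.ofReal_le_ofReal ((hdecay t ht0).trans ?_)
    have := Nat.floor_le ht0
    gcongr A * Real.exp ?_
    nlinarith
  calc ∫⁻ y, ENNReal.ofReal (kernel q K κ ε x y) ∂μ
      ≤ ∫⁻ y, ∑' k : ℕ, (extrinsicBall κ x ((k + 1) * Real.sqrt ε)).indicator
          (fun _ => ENNReal.ofReal (A * Real.exp (-a * k))) y ∂μ := lintegral_mono hpt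
    _ = ∑' k : ℕ, ENNReal.ofReal (A * Real.exp (-a * k)) *
          μ (extrinsicBall κ x ((k + 1) * Real.sqrt ε)) := by
        rw [lintegral_tsum fun k => (measurable_const.indicator
          (measurableSet_extrinsicBall hκ x _)).aemeasurable]
        refine tsum_congr fun k => ?_
        rw [lintegral_indicator_const (measurableSet_extrinsicBall hκ x _)]
    _ ≤ ∑' k : ℕ, ENNReal.ofReal
          (A * C * Real.sqrt ε ^ d * (((k : ℝ) + 1) ^ d * Real.exp (-a * k))) := by
        refine ENNReal.tsum_le_tsum fun k => ?_
        refine (mul_le_mul_right (hball x _ (by positivity)) _).trans (le_of_eq ?_)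
        rw [← ENNReal.ofReal_mul (by positivity)]
        congr 1
        rw [mul_pow]
        ring
    _ = _ := by
        rw [← ENNReal.ofReal_tsum_of_nonneg (fun k => by positivity) (hsummable.mul_left _),
          tsum_mul_left]
        congr 1
        ring

theorem measurable_kernel [SecondCountableTopology M] (hK : IsKernelProfile d K)
    (hκ : Continuous κ) : Measurable (Function.uncurry (kernel q K κ ε)) :=
  (continuous_kernel hK hκ).measurable

theorem integrable_kernel [SecondCountableTopology M] [IsFiniteMeasure μ]
    (hK : IsKernelProfile d K) (hκ : Continuous κ) {A : ℝ}
    (hA : ∀ x y, kernel q K κ ε x y ≤ A) (x : M) : Integrable (kernel q K κ ε x) μ :=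
  Integrable.of_bound
    ((measurable_kernel hK hκ).comp measurable_prodMk_left).aestronglyMeasurable A
    (ae_of_all _ fun y => by
      rw [Real.norm_eq_abs, abs_of_pos (kernel_pos hK x y)]; exact hA x y)

theorem le_integral_kernel [SecondCountableTopology M] [IsFiniteMeasure μ]
    (hK : IsKernelProfile d K) (hκ : Continuous κ) {A b c : ℝ}
    (hA : ∀ x y, kernel q K κ ε x y ≤ A) (hb : 0 < b) (hlow : ∀ t, 0 ≤ t → t ≤ 1 → b ≤ K t)
    (hε : 0 < ε) {x : M}
    (hball : ENNReal.ofReal (c * Real.sqrt ε ^ d) ≤ μ (extrinsicBall κ x (Real.sqrt ε))) :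
    b * c * Real.sqrt ε ^ d ≤ ∫ y, kernel q K κ ε x y ∂μ := by
  have hint := integrable_kernel (μ := μ) hK hκ hA x
  have hS := measurableSet_extrinsicBall hκ x (Real.sqrt ε)
  have hμ : c * Real.sqrt ε ^ d ≤ μ.real (extrinsicBall κ x (Real.sqrt ε)) :=
    (ENNReal.ofReal_le_iff_le_toReal (measure_ne_top _ _)).1 hball
  calc b * c * Real.sqrt ε ^ d ≤ b * μ.real (extrinsicBall κ x (Real.sqrt ε)) := by
        rw [mul_assoc]; gcongr
    _ = ∫ _ in extrinsicBall κ x (Real.sqrt ε), b ∂μ := by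
        rw [setIntegral_const, smul_eq_mul, mul_comm]
    _ ≤ ∫ y in extrinsicBall κ x (Real.sqrt ε), kernel q K κ ε x y ∂μ := by
        refine setIntegral_mono_on (integrable_const b).integrableOn hint.integrableOn hS ?_
        intro y hy
        have h1 : ‖κ x - κ y‖ / Real.sqrt ε ≤ 1 := (div_le_one (Real.sqrt_pos.2 hε)).2 hy
        exact hlow _ (by positivity) (pow_le_one₀ (by positivity) h1)
    _ ≤ ∫ y, kernel q K κ ε x y ∂μ := setIntegral_le_integral hint
        (ae_of_all _ fun y => (kernel_pos hK x y).le)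

/-- Dividing a kernel by `ε ^ (d / 2)` normalizes it, uniformly for small bandwidths. -/
theorem exists_isNormalizedKernel [SecondCountableTopology M] [IsFiniteMeasure μ]
    (hK : IsKernelProfile d K) (hq : q = 1 ∨ q = 2) (hκ : Continuous κ)
    (hball : ∃ c > 0, ∃ C > 0, ∃ r₀ > 0, ∀ x r, 0 < r →
      μ (extrinsicBall κ x r) ≤ ENNReal.ofReal (C * r ^ d) ∧
      (r ≤ r₀ → ENNReal.ofReal (c * r ^ d) ≤ μ (extrinsicBall κ x r))) :
    ∃ C₀ : ℝ, 1 ≤ C₀ ∧ ∃ ε₀ > 0, ∀ C, C₀ ≤ C → ∀ ε, 0 < ε → ε ≤ ε₀ →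
      IsNormalizedKernel (fun x y => (Real.sqrt ε ^ d)⁻¹ * kernel q K κ ε x y) μ C
        (C / Real.sqrt ε ^ d) := by
  obtain ⟨c, hc, D, hD, r₀, hr₀, hball⟩ := hball
  obtain ⟨A, hA, a, ha, hdecay⟩ := hK.exists_le_exp hq
  obtain ⟨b, hb, hlow⟩ := hK.exists_le_on_unit
  obtain ⟨S, hS0, hS⟩ : ∃ S : ℝ, 0 ≤ S ∧ ∀ ε, 0 < ε → ∀ x,
      ∫⁻ y, ENNReal.ofReal (kernel q K κ ε x y) ∂μ ≤ ENNReal.ofReal (S * Real.sqrt ε ^ d) :=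
    ⟨A * D * ∑' k : ℕ, ((k : ℝ) + 1) ^ d * Real.exp (-a * k),
      mul_nonneg (mul_pos hA hD).le (tsum_nonneg fun k => by positivity), fun ε hε x =>
        lintegral_kernel_le hκ hD hA ha (fun x r hr => (hball x r hr).1) hdecay hε x⟩
  refine ⟨max (max 1 A) (max S (b * c)⁻¹), (le_max_left _ _).trans (le_max_left _ _), r₀ ^ 2,
    pow_pos hr₀ 2, fun C hC ε hε hε₀ => ?_⟩
  have hC1 : 1 ≤ C := (le_max_left _ _).trans ((le_max_left _ _).trans hC)
  have hCA : A ≤ C := (le_max_right _ _).trans ((le_max_left _ _).trans hC)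
  have hCS : S ≤ C := (le_max_left _ _).trans ((le_max_right _ _).trans hC)
  have hCb : (b * c)⁻¹ ≤ C := (le_max_right _ _).trans ((le_max_right _ _).trans hC)
  have hsq : 0 < Real.sqrt ε := Real.sqrt_pos.2 hε
  have hsqr : Real.sqrt ε ≤ r₀ := (Real.sqrt_le_left hr₀.le).2 hε₀
  have he : 0 < Real.sqrt ε ^ d := pow_pos hsq d
  have hleA : ∀ x y, kernel q K κ ε x y ≤ A := kernel_le hA ha hdecay
  refine ⟨(measurable_kernel hK hκ).const_mul _,
    fun x y => mul_pos (inv_pos.2 he) (kernel_pos hK x y), fun x y => ?_, hC1,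
    fun x => ?_, fun x => ?_⟩
  · rw [← div_eq_inv_mul]
    exact div_le_div_of_nonneg_right ((hleA x y).trans hCA) he.le
  · rw [integral_const_mul, ← div_eq_inv_mul, le_div_iff₀ he]
    refine le_trans (mul_le_mul_of_nonneg_right ?_ he.le)
      (le_integral_kernel hK hκ hleA hb hlow hε ((hball x _ hsq).2 hsqr))
    exact (inv_le_comm₀ (by positivity) (by positivity)).1 hCb
  · rw [integral_const_mul, ← div_eq_inv_mul, div_le_iff₀ he,
      integral_eq_lintegral_of_nonneg_ae (ae_of_all _ fun y => (kernel_pos hK x y).le)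
        ((measurable_kernel hK hκ).comp measurable_prodMk_left).aestronglyMeasurable]
    exact ENNReal.toReal_le_of_le_ofReal (by positivity)
      ((hS ε hε x).trans (ENNReal.ofReal_le_ofReal (by gcongr)))

/-- Ball bounds pass to measures with a density bounded above and away from zero. -/
theorem withDensity_extrinsicBall {vol : Measure M} {ρ : M → ℝ} (hκ : Continuous κ)
    (hlow : ∃ c > 0, ∀ x, c ≤ ρ x) (hupp : ∃ C > 0, ∀ x, ρ x ≤ C)
    (hball : ∃ c > 0, ∃ C > 0, ∃ r₀ > 0, ∀ x r, 0 < r →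
      vol (extrinsicBall κ x r) ≤ ENNReal.ofReal (C * r ^ d) ∧
      (r ≤ r₀ → ENNReal.ofReal (c * r ^ d) ≤ vol (extrinsicBall κ x r))) :
    ∃ c > 0, ∃ C > 0, ∃ r₀ > 0, ∀ x r, 0 < r →
      vol.withDensity (fun x => ENNReal.ofReal (ρ x)) (extrinsicBall κ x r) ≤
        ENNReal.ofReal (C * r ^ d) ∧
      (r ≤ r₀ → ENNReal.ofReal (c * r ^ d) ≤
        vol.withDensity (fun x => ENNReal.ofReal (ρ x)) (extrinsicBall κ x r)) := by
  obtain ⟨a, ha, hlow⟩ := hlow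
  obtain ⟨b, hb, hupp⟩ := hupp
  obtain ⟨c, hc, C, hC, r₀, hr₀, hball⟩ := hball
  refine ⟨a * c, by positivity, b * C, by positivity, r₀, hr₀, fun x r hr => ?_⟩
  have hS := measurableSet_extrinsicBall hκ x r
  rw [withDensity_apply _ hS]
  refine ⟨?_, fun hrr => ?_⟩
  · calc ∫⁻ y in extrinsicBall κ x r, ENNReal.ofReal (ρ y) ∂vol
        ≤ ∫⁻ _ in extrinsicBall κ x r, ENNReal.ofReal b ∂vol :=
          lintegral_mono fun y => ENNReal.ofReal_le_ofReal (hupp y)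
      _ = ENNReal.ofReal b * vol (extrinsicBall κ x r) := setLIntegral_const _ _
      _ ≤ ENNReal.ofReal b * ENNReal.ofReal (C * r ^ d) := by
          gcongr; exact (hball x r hr).1
      _ = _ := by rw [← ENNReal.ofReal_mul hb.le, mul_assoc]
  · calc ENNReal.ofReal (a * c * r ^ d) = ENNReal.ofReal a * ENNReal.ofReal (c * r ^ d) := by
          rw [← ENNReal.ofReal_mul ha.le, mul_assoc]
      _ ≤ ENNReal.ofReal a * vol (extrinsicBall κ x r) := by
          gcongr; exact (hball x r hr).2 hrr
      _ = ∫⁻ _ in extrinsicBall κ x r, ENNReal.ofReal a ∂vol := (setLIntegral_const _ _).symm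
      _ ≤ _ := lintegral_mono fun y => ENNReal.ofReal_le_ofReal (hlow y)

end KernelBounds

/-! ### The choice of the deviation -/

section Rate

theorem rpow_div_four_sq {d : ℕ} {ε : ℝ} (hε : 0 < ε) :
    (ε ^ ((d : ℝ) / 4)) ^ 2 = Real.sqrt ε ^ d := by
  rw [← Real.rpow_natCast, ← Real.rpow_mul hε.le, Real.sqrt_eq_rpow, ← Real.rpow_natCast,
    ← Real.rpow_mul hε.le]
  congr 1
  push_cast
  ring

/-- With deviation `4 C⁵ ε · rate` and landmark number `⌈n ^ β⌉`, the exponent in the Bernstein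
bound for normalized kernels, with `B = C / ε ^ (d / 2)`, beats the union bound over `n` points: the
failure probability is at most `n · n ^ (-3)` up to a constant. -/
theorem three_mul_log_le {d : ℕ} {β ε C : ℝ} {n : ℕ} (hn : 1 ≤ n) (hε : 0 < ε) (hC : 1 ≤ C) :
    3 * Real.log n ≤ (⌈(n : ℝ) ^ β⌉₊ : ℝ) * (4 * C ^ 5 * (ε * rate d β n ε)) ^ 2 /
      (4 * (C / Real.sqrt ε ^ d * C ^ 9)) := by
  have hn0 : (0 : ℝ) < n := by exact_mod_cast hn
  have hlog : 0 ≤ Real.log n := Real.log_nonneg (by exact_mod_cast hn)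
  have hC0 : 0 < C := by linarith
  have hpow : 0 < (n : ℝ) ^ (β / 2) := Real.rpow_pos_of_pos hn0 _
  have hpow2 : ((n : ℝ) ^ (β / 2)) ^ 2 = (n : ℝ) ^ β := by
    rw [← Real.rpow_natCast, ← Real.rpow_mul hn0.le]
    congr 1
    push_cast
    ring
  have hε4 : 0 < ε ^ ((d : ℝ) / 4) := Real.rpow_pos_of_pos hε _
  have hrate : ε * rate d β n ε =
      Real.sqrt (Real.log n) / ((n : ℝ) ^ (β / 2) * ε ^ ((d : ℝ) / 4)) := by
    unfold rate
    rw [Real.rpow_add hε, Real.rpow_one]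
    field_simp
  have hm : (n : ℝ) ^ β ≤ (⌈(n : ℝ) ^ β⌉₊ : ℝ) := Nat.le_ceil _
  have hnβ : 0 < (n : ℝ) ^ β := Real.rpow_pos_of_pos hn0 _
  have hsq : 0 < Real.sqrt ε ^ d := pow_pos (Real.sqrt_pos.2 hε) d
  have heq : (⌈(n : ℝ) ^ β⌉₊ : ℝ) * (4 * C ^ 5 * (ε * rate d β n ε)) ^ 2 /
      (4 * (C / Real.sqrt ε ^ d * C ^ 9)) =
        4 * Real.log n * ((⌈(n : ℝ) ^ β⌉₊ : ℝ) / (n : ℝ) ^ β) := by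
    rw [hrate, mul_pow, div_pow, mul_pow ((n : ℝ) ^ (β / 2)), hpow2, rpow_div_four_sq hε,
      Real.sq_sqrt hlog]
    field_simp
  rw [heq]
  have h1 : 1 ≤ (⌈(n : ℝ) ^ β⌉₊ : ℝ) / (n : ℝ) ^ β := (one_le_div hnβ).2 hm
  nlinarith

end Rate

end LAD

/-! ### Convergence of the matrix to the operator -/

theorem theorem4p8 {d p₁ p₂ : ℕ}
    -- the common manifold: compact, smooth, `d`-dimensional, without boundary
    {M : Type*} [TopologicalSpace M] [T2Space M] [CompactSpace M]
    [ChartedSpace (EuclideanSpace ℝ (Fin d)) M] [IsManifold (𝓡 d) ∞ M]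
    [MeasurableSpace M] [BorelSpace M]
    -- the two sensors
    (ι₁ : M → EuclideanSpace ℝ (Fin p₁))
    (hι₁ : Manifold.IsSmoothEmbedding (𝓡 d) 𝓘(ℝ, EuclideanSpace ℝ (Fin p₁)) 4 ι₁)
    (ι₂ : M → EuclideanSpace ℝ (Fin p₂))
    (hι₂ : Manifold.IsSmoothEmbedding (𝓡 d) 𝓘(ℝ, EuclideanSpace ℝ (Fin p₂)) 4 ι₂)
    -- the two kernels
    (K₁ K₂ : ℝ → ℝ) (hK₁ : LAD.IsKernelProfile d K₁) (hK₂ : LAD.IsKernelProfile d K₂)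
    (q : ℕ) (hq : q = 1 ∨ q = 2)
    -- the law of the samples
    (ν : Measure M) (p : M → ℝ)
    (hp : ContMDiff (𝓡 d) 𝓘(ℝ, ℝ) 4 p) (hp_lower : ∃ c > 0, ∀ x, c ≤ p x)
    (hν : ν = (LAD.riemannianVolume (d := d) ι₂).withDensity fun x => ENNReal.ofReal (p x))
    -- the law of the landmarks
    (νZ : Measure M) (pZ : M → ℝ)
    (hpZ : Continuous pZ) (hpZ_lower : ∃ c > 0, ∀ x, c ≤ pZ x)
    (hνZ : νZ = (LAD.riemannianVolume (d := d) ι₂).withDensity fun x => ENNReal.ofReal (pZ x))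
    -- the samples `X` and the landmarks `Z`, all independent
    {Ω : Type*} [MeasurableSpace Ω] (P : Measure Ω) [IsProbabilityMeasure P]
    (X Z : ℕ → Ω → M) (hX : ∀ i, Measurable (X i)) (hZ : ∀ k, Measurable (Z k))
    (hX_law : ∀ i, P.map (X i) = ν) (hZ_law : ∀ k, P.map (Z k) = νZ)
    (h_indep : iIndepFun (Sum.elim X Z : ℕ ⊕ ℕ → Ω → M) P)
    -- the parameters and the function
    (α : ℝ) (hα : α ∈ Set.Icc (0 : ℝ) 1) (β : ℝ) (hβ : β ∈ Set.Ioc (0 : ℝ) 1)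
    (f : M → ℝ) (hf : ContMDiff (𝓡 d) 𝓘(ℝ, ℝ) 3 f) :
    ∃ C : ℝ, 0 < C ∧ ∀ ε : ℕ → ℝ, (∀ n, 0 < ε n) → Tendsto ε atTop (𝓝 0) →
      Tendsto (fun n => LAD.rate d β n (ε n)) atTop (𝓝 0) →
      ∀ᶠ n : ℕ in atTop,
        1 - C / (n : ℝ) ^ 2 ≤
          P.real {w | ∀ i : Fin n,
            let k₁ := LAD.kernel q K₁ ι₁ (ε n)
            let k₂ := LAD.kernel q K₂ ι₂ (ε n)
            let x : Fin n → M := fun j => X j w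
            let z : Fin ⌈(n : ℝ) ^ β⌉₊ → M := fun k => Z k w
            |(1 / ε n) * ((1 - LAD.ladMatrix k₁ k₂ α x z) *ᵥ fun j => f (x j)) i -
                (f (x i) - LAD.adOperator k₁ k₂ ν νZ α f (x i)) / ε n| ≤
              C * LAD.rate d β n (ε n)} := by
  have hone : (1 : ℕ∞ω) ≤ 4 := by norm_num
  have : IsManifold (𝓡 d) 1 M := IsManifold.of_le (n := ∞) (by norm_num)
  have : SecondCountableTopology M :=
    ChartedSpace.secondCountable_of_sigmaCompact (EuclideanSpace ℝ (Fin d)) M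
  have hνprob : IsProbabilityMeasure ν :=
    hX_law 0 ▸ Measure.isProbabilityMeasure_map (hX 0).aemeasurable
  have hνZprob : IsProbabilityMeasure νZ :=
    hZ_law 0 ▸ Measure.isProbabilityMeasure_map (hZ 0).aemeasurable
  have hM : Nonempty M := nonempty_of_isProbabilityMeasure ν
  have hι₁c : Continuous ι₁ := hι₁.contMDiff.continuous
  have hι₂c : Continuous ι₂ := hι₂.contMDiff.continuous
  have hfc : Continuous f := hf.continuous
  have hbdd : ∀ g : M → ℝ, Continuous g → ∃ C > 0, ∀ x, g x ≤ C := by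
    intro g hg
    obtain ⟨C, hC⟩ := (isCompact_range hg).bddAbove
    exact ⟨max C 1, by positivity, fun x => (hC ⟨x, rfl⟩).trans (le_max_left _ _)⟩
  -- uniform constants for the three normalized kernels
  obtain ⟨C₁, hC₁, ε₁, hε₁, hk₁⟩ := LAD.exists_isNormalizedKernel (μ := νZ) hK₁ hq hι₁c <| hνZ ▸
    LAD.withDensity_extrinsicBall hι₁c hpZ_lower (hbdd pZ hpZ)
      (LAD.riemannianVolume_extrinsicBall hone hι₂ hι₁)
  obtain ⟨C₂, hC₂, ε₂, hε₂, hk₂⟩ := LAD.exists_isNormalizedKernel (μ := ν) hK₂ hq hι₂c <| hν ▸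
    LAD.withDensity_extrinsicBall hι₂c hp_lower (hbdd p hp.continuous)
      (LAD.riemannianVolume_extrinsicBall hone hι₂ hι₂)
  obtain ⟨C₃, hC₃, ε₃, hε₃, hk₃⟩ := LAD.exists_isNormalizedKernel (μ := νZ) hK₂ hq hι₂c <| hνZ ▸
    LAD.withDensity_extrinsicBall hι₂c hpZ_lower (hbdd pZ hpZ)
      (LAD.riemannianVolume_extrinsicBall hone hι₂ hι₂)
  obtain ⟨F, hF, hfF⟩ := hbdd (fun x => |f x|) hfc.abs
  set C := max (max C₁ C₂) (max C₃ F) with hC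
  have hCC₁ : C₁ ≤ C := (le_max_left _ _).trans (le_max_left _ _)
  have hCC₂ : C₂ ≤ C := (le_max_right _ _).trans (le_max_left _ _)
  have hCC₃ : C₃ ≤ C := (le_max_left _ _).trans (le_max_right _ _)
  have hfC : ∀ x, |f x| ≤ C := fun x => (hfF x).trans ((le_max_right _ _).trans (le_max_right _ _))
  have hC1 : 1 ≤ C := hC₁.trans hCC₁
  have hC0 : 0 < C := by linarith
  -- `272 C ^ 29 = 68 C ^ 24 · 4 C ^ 5`: the deterministic error bound at deviation
  -- `4 C ^ 5 ε · rate`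
  refine ⟨272 * C ^ 29, by positivity, fun ε hε hε0 hrate => ?_⟩
  have hδ : Tendsto (fun n => 34 * C ^ 15 * (4 * C ^ 5 * (ε n * LAD.rate d β n (ε n)))) atTop
      (𝓝 0) := by
    have := ((hε0.mul hrate).const_mul (4 * C ^ 5)).const_mul (34 * C ^ 15)
    simpa using this
  filter_upwards [eventually_ge_atTop 1, hδ.eventually (gt_mem_nhds one_pos),
    hε0.eventually (gt_mem_nhds hε₁), hε0.eventually (gt_mem_nhds hε₂),
    hε0.eventually (gt_mem_nhds hε₃)] with n hn hsmall hn₁ hn₂ hn₃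
  set m := ⌈(n : ℝ) ^ β⌉₊ with hm
  have hn1 : (1 : ℝ) ≤ n := by exact_mod_cast hn
  have hn0 : (0 : ℝ) < n := by linarith
  have hm0 : 0 < m := Nat.ceil_pos.2 (Real.rpow_pos_of_pos hn0 _)
  have hmn : m ≤ n := by
    refine Nat.ceil_le.2 ?_
    calc (n : ℝ) ^ β ≤ (n : ℝ) ^ (1 : ℝ) := Real.rpow_le_rpow_of_exponent_le hn1 hβ.2
      _ = n := Real.rpow_one _
  have hsq : 0 < (Real.sqrt (ε n) ^ d)⁻¹ := inv_pos.2 (pow_pos (Real.sqrt_pos.2 (hε n)) d)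
  have hpair : LAD.IsNormalizedPair
      (fun x y => (Real.sqrt (ε n) ^ d)⁻¹ * LAD.kernel q K₁ ι₁ (ε n) x y)
      (fun x y => (Real.sqrt (ε n) ^ d)⁻¹ * LAD.kernel q K₂ ι₂ (ε n) x y) ν νZ C
      (C / Real.sqrt (ε n) ^ d) :=
    ⟨hk₁ C hCC₁ _ (hε n) hn₁.le, hk₂ C hCC₂ _ (hε n) hn₂.le, hk₃ C hCC₃ _ (hε n) hn₃.le,
      fun x y => by rw [LAD.kernel_symm]⟩
  have hrate0 : 0 ≤ LAD.rate d β n (ε n) := by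
    have := (hε n).le
    unfold LAD.rate
    positivity
  have hη0 : 0 ≤ 4 * C ^ 5 * (ε n * LAD.rate d β n (ε n)) := by
    have := (hε n).le
    positivity
  have hprob := hpair.measureReal_not_forall_le h_indep hX hZ hX_law hZ_law hα hfc.measurable hfC
    hη0 hsmall.le hm0 hmn
  have hexp : 12 * ((n : ℝ) * Real.exp (-(m * (4 * C ^ 5 * (ε n * LAD.rate d β n (ε n))) ^ 2 /
      (4 * (C / Real.sqrt (ε n) ^ d * C ^ 9))))) ≤ 272 * C ^ 29 / (n : ℝ) ^ 2 := by
    have h1 : Real.exp (-(m * (4 * C ^ 5 * (ε n * LAD.rate d β n (ε n))) ^ 2 /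
        (4 * (C / Real.sqrt (ε n) ^ d * C ^ 9)))) ≤ ((n : ℝ) ^ 3)⁻¹ := by
      calc _ ≤ Real.exp (-(3 * Real.log n)) := by
            rw [Real.exp_le_exp, neg_le_neg_iff]
            exact LAD.three_mul_log_le hn (hε n) hC1
        _ = ((n : ℝ) ^ 3)⁻¹ := by
            rw [Real.exp_neg, ← Nat.cast_ofNat, Real.exp_nat_mul, Real.exp_log hn0]
    calc _ ≤ 12 * ((n : ℝ) * ((n : ℝ) ^ 3)⁻¹) := by gcongr
      _ = 12 / (n : ℝ) ^ 2 := by field_simp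
      _ ≤ _ := by
          have : 1 ≤ C ^ 29 := one_le_pow₀ hC1
          gcongr
          linarith
  set good := {w | ∀ i : Fin n,
    |(1 / ε n) * ((1 - LAD.ladMatrix (LAD.kernel q K₁ ι₁ (ε n)) (LAD.kernel q K₂ ι₂ (ε n)) α
        (fun j : Fin n => X j w) (fun k : Fin m => Z k w)) *ᵥ fun j : Fin n => f (X j w)) i -
      (f (X i w) - LAD.adOperator (LAD.kernel q K₁ ι₁ (ε n)) (LAD.kernel q K₂ ι₂ (ε n)) ν νZ α f
        (X i w)) / ε n| ≤ 272 * C ^ 29 * LAD.rate d β n (ε n)} with hgood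
  show 1 - 272 * C ^ 29 / (n : ℝ) ^ 2 ≤ P.real good
  have hcover : (Set.univ : Set Ω) ⊆ good ∪ {w | ¬ ∀ i : Fin n,
      |(LAD.ladMatrix (fun x y => (Real.sqrt (ε n) ^ d)⁻¹ * LAD.kernel q K₁ ι₁ (ε n) x y)
        (fun x y => (Real.sqrt (ε n) ^ d)⁻¹ * LAD.kernel q K₂ ι₂ (ε n) x y) α
        (fun j : Fin n => X j w) (fun k : Fin m => Z k w) *ᵥ fun j => f (X j w)) i -
        LAD.adOperator (fun x y => (Real.sqrt (ε n) ^ d)⁻¹ * LAD.kernel q K₁ ι₁ (ε n) x y)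
        (fun x y => (Real.sqrt (ε n) ^ d)⁻¹ * LAD.kernel q K₂ ι₂ (ε n) x y) ν νZ α f (X i w)| ≤
        68 * C ^ 24 * (4 * C ^ 5 * (ε n * LAD.rate d β n (ε n)))} := by
    intro w _
    rw [Set.mem_union, or_iff_not_imp_right]
    intro hw i
    have hi := not_not.1 hw i
    rw [LAD.ladMatrix_mulVec_const_mul hsq LAD.kernel_symm (LAD.kernel_pos hK₁)
        (LAD.kernel_pos hK₂) hm0 f i,
      LAD.adOperator_const_mul hsq fun ζ => integral_nonneg fun _ => integral_nonneg fun _ =>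
        mul_nonneg (LAD.kernel_pos hK₂ _ _).le (LAD.kernel_pos hK₂ _ _).le] at hi
    have hεn := hε n
    rw [Matrix.sub_mulVec, Matrix.one_mulVec, Pi.sub_apply]
    have hfactor : ∀ a b c : ℝ, 1 / ε n * (a - b) - (a - c) / ε n = -((b - c) / ε n) := by
      intro a b c; field_simp; ring
    rw [hfactor, abs_neg, abs_div, abs_of_pos hεn, div_le_iff₀ hεn]
    refine hi.trans (le_of_eq ?_)
    ring
  have h1 : (1 : ℝ) ≤ P.real good + _ :=
    (probReal_univ (μ := P)).symm.le.trans
      ((measureReal_mono hcover).trans (measureReal_union_le _ _))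
  linarith
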